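/- Let $(M,g)$ be a connected smooth Riemannian manifold of dimension $6$ with Levi-Civita connection $\nabla^g$, and let $T$ be a smooth $3$-form on $M$. Let $\nabla=\nabla^g+\frac12 T$, i.e. $g(\nabla_XY,Z)=g(\nabla^g_XY,Z)+\frac12T(X,Y,Z)$, be the metric connection with totally skew-symmetric torsion $T$. Let $dT$ be the exterior derivative and $\delta T_{ij}=-\nabla^g_sT_{sij}$ the codifferential of $T$, and define the $1$-forms $\theta_j=\delta T_{ab}\,T_{jab}$ and $\Theta_j=T_{abc}\,dT_{jabc}$ (indices refer to a local orthonormal frame, repeated indices are summed). Let $Ric(X,Y)=\sum_i g(R(e_i,X)Y,e_i)$, where $R(X,Y)=[\nabla_X,\nabla_Y]-\nabla_{[X,Y]}$, be the Ricci tensor of $\nabla$, and call $\nabla$ $\nabla$-Einstein if there is a function $\lambda$ on $M$ with $\frac12\big(Ric(X,Y)+Ric(Y,X)\big)=\lambda\, g(X,Y)$ for all $X,Y$. If $3\theta+\Theta=0$ on $M$ and $\nabla$ is $\nabla$-Einstein, then the Riemannian scalar curvature $Scal^g$ (the scalar curvature of $\nabla^g$) is constant. The condition $3\theta+\Theta=0$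 holds in particular if $T$ is harmonic, i.e. $dT=0$ and $\delta T=0$. -/

import Mathlib

open Bundle FiberBundle VectorField
open scoped Manifold ContDiff Topology

namespace TorsionGeometry

noncomputable section


variable {E : Type*} [NormedAddCommGroup E] [NormedSpace ℝ E] [FiniteDimensional ℝ E]
  {H : Type*} [TopologicalSpace H] (I : ModelWithCorners ℝ E H)
  {M : Type*} [TopologicalSpace M] [ChartedSpace H M]

instance tangentSpaceFiniteDimensional (x : M) : FiniteDimensional ℝ (TangentSpace I x) :=
  inferInstanceAs (FiniteDimensional ℝ E)

variable [RiemannianBundle (fun x : M ↦ TangentSpace I x)]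

/-- Right-hand side of the Koszul formula, `2 ⟨∇_X Y, Z⟩` at the point `x`. -/
def koszul (X Y Z : Π x : M, TangentSpace I x) (x : M) : ℝ :=
  d% (fun y ↦ inner ℝ (Y y) (Z y)) x (X x) + d% (fun y ↦ inner ℝ (Z y) (X y)) x (Y x)
    - d% (fun y ↦ inner ℝ (X y) (Y y)) x (Z x)
    + inner ℝ (mlieBracket I X Y x) (Z x) - inner ℝ (mlieBracket I Y Z x) (X x)
    + inner ℝ (mlieBracket I Z X x) (Y x)

variable [IsManifold I ∞ M] [IsContMDiffRiemannianBundle I ∞ E (fun x : M ↦ TangentSpace I x)]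

variable {I} in
theorem mdiff_inner {X Y : Π x : M, TangentSpace I x} {x : M} (hX : MDiffAt (T% X) x)
    (hY : MDiffAt (T% Y) x) : MDiffAt (fun y ↦ inner ℝ (X y) (Y y)) x :=
  MDifferentiableAt.inner_bundle (E := fun x : M ↦ TangentSpace I x) (F := E) hX hY

theorem koszul_tensorial_left (Y Z : Π x : M, TangentSpace I x) {x : M}
    (hY : MDiffAt (T% Y) x) (hZ : MDiffAt (T% Z) x) :
    TensorialAt I E (fun X ↦ koszul I X Y Z x) x where
  smul {f X} hf hX := by
    have h1 := mvfderiv_mul hf (mdiff_inner hZ hX)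
    have h2 := mvfderiv_mul hf (mdiff_inner hX hY)
    have e1 : (fun y ↦ inner ℝ (Z y) ((f • X) y)) = f * fun y ↦ inner ℝ (Z y) (X y) := by
      ext y; simp [inner_smul_right]
    have e2 : (fun y ↦ inner ℝ ((f • X) y) (Y y)) = f * fun y ↦ inner ℝ (X y) (Y y) := by
      ext y; simp [inner_smul_left]
    rw [koszul, e1, e2, h1, h2, mlieBracket_smul_left hf hX, mlieBracket_smul_right hf hX]
    simp [koszul, inner_smul_left, inner_smul_right, inner_add_left]
    rw [real_inner_comm (X x) (Z x)]
    ring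
  add {X X'} hX hX' := by
    have h1 := mvfderiv_add (mdiff_inner hZ hX) (mdiff_inner hZ hX')
    have h2 := mvfderiv_add (mdiff_inner hX hY) (mdiff_inner hX' hY)
    have e1 : (fun y ↦ inner ℝ (Z y) ((X + X') y)) =
      (fun y ↦ inner ℝ (Z y) (X y)) + fun y ↦ inner ℝ (Z y) (X' y) := by
      ext y; simp [inner_add_right]
    have e2 : (fun y ↦ inner ℝ ((X + X') y) (Y y)) =
      (fun y ↦ inner ℝ (X y) (Y y)) + fun y ↦ inner ℝ (X' y) (Y y) := by
      ext y; simp [inner_add_left]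
    rw [koszul, e1, e2, h1, h2, mlieBracket_add_left hX hX', mlieBracket_add_right hX hX']
    simp [koszul, inner_add_left, inner_add_right]
    ring

theorem koszul_tensorial_right (X Y : Π x : M, TangentSpace I x) {x : M}
    (hX : MDiffAt (T% X) x) (hY : MDiffAt (T% Y) x) :
    TensorialAt I E (fun Z ↦ koszul I X Y Z x) x where
  smul {f Z} hf hZ := by
    have h1 := mvfderiv_mul hf (mdiff_inner hY hZ)
    have h2 := mvfderiv_mul hf (mdiff_inner hZ hX)
    have e1 : (fun y ↦ inner ℝ (Y y) ((f • Z) y)) = f * fun y ↦ inner ℝ (Y y) (Z y) := by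
      ext y; simp [inner_smul_right]
    have e2 : (fun y ↦ inner ℝ ((f • Z) y) (X y)) = f * fun y ↦ inner ℝ (Z y) (X y) := by
      ext y; simp [inner_smul_left]
    rw [koszul, e1, e2, h1, h2, mlieBracket_smul_left hf hZ, mlieBracket_smul_right hf hZ]
    simp [koszul, inner_smul_left, inner_smul_right, inner_add_left]
    rw [real_inner_comm (Y x) (Z x)]
    ring
  add {Z Z'} hZ hZ' := by
    have h1 := mvfderiv_add (mdiff_inner hY hZ) (mdiff_inner hY hZ')
    have h2 := mvfderiv_add (mdiff_inner hZ hX) (mdiff_inner hZ' hX)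
    have e1 : (fun y ↦ inner ℝ (Y y) ((Z + Z') y)) =
      (fun y ↦ inner ℝ (Y y) (Z y)) + fun y ↦ inner ℝ (Y y) (Z' y) := by
      ext y; simp [inner_add_right]
    have e2 : (fun y ↦ inner ℝ ((Z + Z') y) (X y)) =
      (fun y ↦ inner ℝ (Z y) (X y)) + fun y ↦ inner ℝ (Z' y) (X y) := by
      ext y; simp [inner_add_left]
    rw [koszul, e1, e2, h1, h2, mlieBracket_add_left hZ hZ', mlieBracket_add_right hZ hZ']
    simp [koszul, inner_add_left, inner_add_right]
    ring

theorem koszul_add {X Y Y' Z : Π x : M, TangentSpace I x} {x : M} (hX : MDiffAt (T% X) x)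
    (hY : MDiffAt (T% Y) x) (hY' : MDiffAt (T% Y') x) (hZ : MDiffAt (T% Z) x) :
    koszul I X (Y + Y') Z x = koszul I X Y Z x + koszul I X Y' Z x := by
  have h1 := mvfderiv_add (mdiff_inner hY hZ) (mdiff_inner hY' hZ)
  have h2 := mvfderiv_add (mdiff_inner hX hY) (mdiff_inner hX hY')
  have e1 : (fun y ↦ inner ℝ ((Y + Y') y) (Z y)) =
    (fun y ↦ inner ℝ (Y y) (Z y)) + fun y ↦ inner ℝ (Y' y) (Z y) := by
    ext y; simp [inner_add_left]
  have e2 : (fun y ↦ inner ℝ (X y) ((Y + Y') y)) =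
    (fun y ↦ inner ℝ (X y) (Y y)) + fun y ↦ inner ℝ (X y) (Y' y) := by
    ext y; simp [inner_add_right]
  rw [koszul, e1, e2, h1, h2, mlieBracket_add_left hY hY', mlieBracket_add_right hY hY']
  simp [koszul, inner_add_left, inner_add_right]
  ring

theorem koszul_leibniz {X Y Z : Π x : M, TangentSpace I x} {f : M → ℝ} {x : M}
    (hX : MDiffAt (T% X) x) (hY : MDiffAt (T% Y) x) (hZ : MDiffAt (T% Z) x) (hf : MDiffAt f x) :
    koszul I X (f • Y) Z x =
      f x * koszul I X Y Z x + 2 * (d% f x (X x) * inner ℝ (Y x) (Z x)) := by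
  have h1 := mvfderiv_mul hf (mdiff_inner hY hZ)
  have h2 := mvfderiv_mul hf (mdiff_inner hX hY)
  have e1 : (fun y ↦ inner ℝ ((f • Y) y) (Z y)) = f * fun y ↦ inner ℝ (Y y) (Z y) := by
    ext y; simp [inner_smul_left]
  have e2 : (fun y ↦ inner ℝ (X y) ((f • Y) y)) = f * fun y ↦ inner ℝ (X y) (Y y) := by
    ext y; simp [inner_smul_right]
  rw [koszul, e1, e2, h1, h2, mlieBracket_smul_left hf hY, mlieBracket_smul_right hf hY]
  simp [koszul, inner_smul_left, inner_smul_right, inner_add_left]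
  rw [real_inner_comm (X x) (Y x)]
  ring

open Classical in
/-- The Levi-Civita connection as an operator on vector fields: `∇_v Y` is the vector with
`2 ⟨∇_v Y, Z⟩ = koszul v Y Z` for all `Z` (and `0` if `Y` is not differentiable at `x`). -/
def leviCivitaFun (Y : Π x : M, TangentSpace I x) (x : M) :
    TangentSpace I x →L[ℝ] TangentSpace I x :=
  if hY : MDiffAt (T% Y) x then
    letI K := TensorialAt.mkHom₂ (fun X Z ↦ koszul I X Y Z x) x
        (fun Z hZ ↦ koszul_tensorial_left I Y Z hY hZ)
        (fun X hX ↦ koszul_tensorial_right I X Y hX hY)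
    LinearMap.toContinuousLinearMap
      { toFun := fun v ↦ (InnerProductSpace.toDual ℝ (TangentSpace I x)).symm ((1 / 2 : ℝ) • K v)
        map_add' := fun v w ↦ by simp
        map_smul' := fun c v ↦ by
          simp only [map_smul, RingHom.id_apply, smul_comm c (1 / 2 : ℝ)] }
  else 0

theorem inner_leviCivitaFun {X Y Z : Π x : M, TangentSpace I x} {x : M}
    (hX : MDiffAt (T% X) x) (hY : MDiffAt (T% Y) x) (hZ : MDiffAt (T% Z) x) :
    inner ℝ (leviCivitaFun I Y x (X x)) (Z x) = 1 / 2 * koszul I X Y Z x := by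
  rw [leviCivitaFun, dif_pos hY]
  simp only [LinearMap.coe_toContinuousLinearMap', LinearMap.coe_mk, AddHom.coe_mk,
    InnerProductSpace.toDual_symm_apply]
  have := TensorialAt.mkHom₂_apply (F := E) (F' := E) (Φ := fun X Z ↦ koszul I X Y Z x) (x := x)
        (fun Z hZ ↦ koszul_tensorial_left I Y Z hY hZ)
        (fun X hX ↦ koszul_tensorial_right I X Y hX hY) hX hZ
  simp [this]

theorem isCovariantDerivativeOn_leviCivitaFun :
    IsCovariantDerivativeOn E (leviCivitaFun I (M := M)) Set.univ where
  add {Y Y' x} hY hY' _ := by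
    ext v
    refine ext_inner_right ℝ fun w ↦ ?_
    have hv := mdifferentiableAt_extend I E v
    have hw := mdifferentiableAt_extend I E w
    have a1 := inner_leviCivitaFun I hv (mdifferentiableAt_add_section hY hY') hw
    have a2 := inner_leviCivitaFun I hv hY hw
    have a3 := inner_leviCivitaFun I hv hY' hw
    simp only [extend_apply_self] at a1 a2 a3
    rw [_root_.add_apply, inner_add_left, a2, a3]
    refine a1.trans ?_
    rw [koszul_add I hv hY hY' hw]
    ring
  leibniz {Y f x} hY hf _ := by
    ext v
    refine ext_inner_right ℝ fun w ↦ ?_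
    have hv := mdifferentiableAt_extend I E v
    have hw := mdifferentiableAt_extend I E w
    have a1 := inner_leviCivitaFun I hv (hf.smul_section hY) hw
    have a2 := inner_leviCivitaFun I hv hY hw
    simp only [extend_apply_self] at a1 a2
    refine a1.trans ?_
    rw [koszul_leibniz I hv hY hw hf]
    simp [inner_add_left, inner_smul_left, a2]
    ring

/-- The Levi-Civita connection of the Riemannian metric. -/
def leviCivita : CovariantDerivative I E (fun x : M ↦ TangentSpace I x) :=
  ⟨leviCivitaFun I, isCovariantDerivativeOn_leviCivitaFun I⟩

theorem leviCivita_torsion : (leviCivita I (M := M)).torsion = 0 := by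
  rw [CovariantDerivative.torsion_eq_zero_iff]
  intro X Y x hX hY
  refine ext_inner_right ℝ fun w ↦ ?_
  have hw := mdifferentiableAt_extend I E w
  have a1 := inner_leviCivitaFun I hX hY hw
  have a2 := inner_leviCivitaFun I hY hX hw
  simp only [extend_apply_self] at a1 a2
  simp only [leviCivita]
  rw [inner_sub_left, a1, a2]
  simp only [koszul, extend_apply_self]
  rw [mlieBracket_swap_apply (V := extend E w) (W := X),
   mlieBracket_swap_apply (V := extend E w) (W := Y), mlieBracket_swap_apply (V := Y) (W := X)]
  simp only [inner_neg_left, real_inner_comm]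
  ring

theorem leviCivita_metric {X Y Z : Π x : M, TangentSpace I x} {x : M}
    (hX : MDiffAt (T% X) x) (hY : MDiffAt (T% Y) x) (hZ : MDiffAt (T% Z) x) :
    d% (fun y ↦ inner ℝ (Y y) (Z y)) x (X x) = inner ℝ (leviCivita I Y x (X x)) (Z x)
      + inner ℝ (Y x) (leviCivita I Z x (X x)) := by
  rw [real_inner_comm _ (Y x)]
  have a1 := inner_leviCivitaFun I hX hY hZ
  have a2 := inner_leviCivitaFun I hX hZ hY
  simp only [leviCivita]
  rw [a1, a2]
  simp only [koszul]
  rw [mlieBracket_swap_apply (V := Z) (W := Y),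
   mlieBracket_swap_apply (V := X) (W := Y), mlieBracket_swap_apply (V := Z) (W := X)]
  simp only [inner_neg_left, real_inner_comm]
  ring

theorem leviCivita_isMetricCompatible :
    (leviCivita I (M := M)).IsMetricCompatible (V := fun x : M ↦ TangentSpace I x) := by
  rw [CovariantDerivative.isMetricCompatible_iff]
  intro x X Y Z hX hY hZ
  exact leviCivita_metric I hX hY hZ

/-! ### Differential 3-forms -/

/-- Smoothness of a 3-form: its values on smooth vector fields are smooth functions. -/
def IsSmoothForm (T : Π x : M, TangentSpace I x [⋀^Fin 3]→L[ℝ] ℝ) : Prop :=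
  ∀ (x : M) (X : Fin 3 → Π y : M, TangentSpace I y), (∀ i, CMDiffAt ∞ (T% (X i)) x) →
    CMDiffAt ∞ (fun y ↦ T y (fun i ↦ X i y)) x

/-- The exterior derivative of a 3-form on vector fields, by Cartan's invariant formula. -/
def extDerivOnFields (T : Π x : M, TangentSpace I x [⋀^Fin 3]→L[ℝ] ℝ)
    (X Y Z V : Π x : M, TangentSpace I x) (x : M) : ℝ :=
  d% (fun y ↦ T y ![Y y, Z y, V y]) x (X x) - d% (fun y ↦ T y ![X y, Z y, V y]) x (Y x)
    + d% (fun y ↦ T y ![X y, Y y, V y]) x (Z x) - d% (fun y ↦ T y ![X y, Y y, Z y]) x (V x)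
    - T x ![mlieBracket I X Y x, Z x, V x] + T x ![mlieBracket I X Z x, Y x, V x]
    - T x ![mlieBracket I X V x, Y x, Z x] - T x ![mlieBracket I Y Z x, X x, V x]
    + T x ![mlieBracket I Y V x, X x, Z x] - T x ![mlieBracket I Z V x, X x, Y x]

/-- The exterior derivative `dT` at `x` on tangent vectors, which are extended to vector fields
near `x` (the value does not depend on the extension). -/
def extDeriv (T : Π x : M, TangentSpace I x [⋀^Fin 3]→L[ℝ] ℝ) (x : M)
    (u v w z : TangentSpace I x) : ℝ :=
  extDerivOnFields I T (extend E u) (extend E v) (extend E w) (extend E z) x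

/-- The covariant derivative `(D_u T)(v₀, v₁, v₂)` of a 3-form. -/
def covDerivForm (D : CovariantDerivative I E (fun x : M ↦ TangentSpace I x))
    (T : Π x : M, TangentSpace I x [⋀^Fin 3]→L[ℝ] ℝ) (x : M) (u : TangentSpace I x)
    (v : Fin 3 → TangentSpace I x) : ℝ :=
  d% (fun y ↦ T y (fun i ↦ extend E (v i) y)) x u
    - ∑ i, T x (Function.update v i (D (extend E (v i)) x u))

/-- An orthonormal basis of the tangent space at `x`. -/
def frame (x : M) :
    OrthonormalBasis (Fin (Module.finrank ℝ (TangentSpace I x))) ℝ (TangentSpace I x) :=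
  stdOrthonormalBasis ℝ (TangentSpace I x)

/-- The codifferential `(δT)(u, v) = - ∑ᵢ (∇^g_{eᵢ} T)(eᵢ, u, v)`. -/
def codiff (T : Π x : M, TangentSpace I x [⋀^Fin 3]→L[ℝ] ℝ) (x : M) (u v : TangentSpace I x) : ℝ :=
  - ∑ i, covDerivForm I (leviCivita I) T x (frame I x i) ![frame I x i, u, v]

/-- `T` is harmonic: `dT = 0` and `δT = 0`. -/
def IsHarmonic (T : Π x : M, TangentSpace I x [⋀^Fin 3]→L[ℝ] ℝ) : Prop :=
  (∀ (x : M) (u v w z : TangentSpace I x), extDeriv I T x u v w z = 0) ∧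
    ∀ (x : M) (u v : TangentSpace I x), codiff I T x u v = 0

/-- The torsion 1-form `θ_j = (δT)_{ab} T_{jab}`. -/
def theta (T : Π x : M, TangentSpace I x [⋀^Fin 3]→L[ℝ] ℝ) (x : M) (u : TangentSpace I x) : ℝ :=
  ∑ a, ∑ b, codiff I T x (frame I x a) (frame I x b) * T x ![u, frame I x a, frame I x b]

/-- The torsion 1-form `Θ_j = T_{abc} (dT)_{jabc}`. -/
def bigTheta (T : Π x : M, TangentSpace I x [⋀^Fin 3]→L[ℝ] ℝ) (x : M) (u : TangentSpace I x) : ℝ :=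
  ∑ a, ∑ b, ∑ c, T x ![frame I x a, frame I x b, frame I x c] *
    extDeriv I T x u (frame I x a) (frame I x b) (frame I x c)

/-! ### The torsion connection -/

/-- The vector-valued form of a 3-form: `⟨T(u, v), w⟩ = T(u, v, w)`. -/
def sharp (T : Π x : M, TangentSpace I x [⋀^Fin 3]→L[ℝ] ℝ) (x : M) (u v : TangentSpace I x) :
    TangentSpace I x :=
  ∑ i, T x ![u, v, frame I x i] • frame I x i

variable {I} in
theorem inner_sharp (T : Π x : M, TangentSpace I x [⋀^Fin 3]→L[ℝ] ℝ) (x : M)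
    (u v w : TangentSpace I x) : inner ℝ (sharp I T x u v) w = T x ![u, v, w] := by
  have key : ∀ z, T x ![u, v, z] =
      ((T x).toContinuousMultilinearMap.toContinuousLinearMap ![u, v, 0] 2) z := by
    intro z
    simp only [ContinuousMultilinearMap.toContinuousLinearMap_apply,
      ContinuousAlternatingMap.coe_toContinuousMultilinearMap]
    congr 1
    ext i
    fin_cases i <;> simp
  conv_rhs => rw [← (frame I x).sum_repr' w, key, map_sum]
  refine (sum_inner _ _ _).trans (Finset.sum_congr rfl fun i _ ↦ ?_)
  rw [map_smul, ← key, inner_smul_left, smul_eq_mul, conj_trivial, mul_comm]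

theorem sharp_add_left (T : Π x : M, TangentSpace I x [⋀^Fin 3]→L[ℝ] ℝ) (x : M)
    (u u' v : TangentSpace I x) :
    sharp I T x (u + u') v = sharp I T x u v + sharp I T x u' v := by
  refine ext_inner_right ℝ fun w ↦ ?_
  simp only [inner_add_left, inner_sharp]
  exact (T x).toAlternatingMap.map_vecCons_add ![v, w] u u'

theorem sharp_smul_left (T : Π x : M, TangentSpace I x [⋀^Fin 3]→L[ℝ] ℝ) (x : M) (c : ℝ)
    (u v : TangentSpace I x) : sharp I T x (c • u) v = c • sharp I T x u v := by
  refine ext_inner_right ℝ fun w ↦ ?_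
  simp only [inner_smul_left, inner_sharp]
  exact (T x).toAlternatingMap.map_vecCons_smul ![v, w] c u

theorem sharp_swap (T : Π x : M, TangentSpace I x [⋀^Fin 3]→L[ℝ] ℝ) (x : M)
    (u v : TangentSpace I x) : sharp I T x u v = - sharp I T x v u := by
  refine ext_inner_right ℝ fun w ↦ ?_
  rw [inner_neg_left, inner_sharp, inner_sharp]
  have := (T x).toAlternatingMap.map_swap ![v, u, w] (i := 0) (j := 1) (by decide)
  rw [ContinuousAlternatingMap.coe_toAlternatingMap] at this
  rw [← this]
  congr 1
  ext i
  fin_cases i <;> simp [Equiv.swap_apply_def]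

/-- The torsion connection `∇_X Y = ∇^g_X Y + (1 / 2) T(X, Y)`, i.e. the metric connection with
skew-symmetric torsion `T`. -/
def torsionConnection (T : Π x : M, TangentSpace I x [⋀^Fin 3]→L[ℝ] ℝ) :
    CovariantDerivative I E (fun x : M ↦ TangentSpace I x) :=
  (leviCivita I).addOneForm fun x ↦ LinearMap.toContinuousBilinearMap
    (LinearMap.mk₂ ℝ (fun v u : TangentSpace I x ↦ (1 / 2 : ℝ) • sharp I T x u v)
      (fun v v' u ↦ by
        rw [sharp_swap, sharp_add_left, sharp_swap I T x u v, sharp_swap I T x u v']; module)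
      (fun c v u ↦ by
        rw [sharp_swap, sharp_smul_left, sharp_swap I T x u v]; module)
      (fun v u u' ↦ by rw [sharp_add_left, smul_add])
      (fun c v u ↦ by rw [sharp_smul_left, smul_comm]))

theorem torsionConnection_apply (T : Π x : M, TangentSpace I x [⋀^Fin 3]→L[ℝ] ℝ)
    (Y : Π x : M, TangentSpace I x) (x : M) (u : TangentSpace I x) :
    torsionConnection I T Y x u = leviCivita I Y x u + (1 / 2 : ℝ) • sharp I T x u (Y x) := rfl

theorem torsionConnection_isMetricCompatible
    (T : Π x : M, TangentSpace I x [⋀^Fin 3]→L[ℝ] ℝ) :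
    (torsionConnection I T).IsMetricCompatible (V := fun x : M ↦ TangentSpace I x) := by
  rw [CovariantDerivative.isMetricCompatible_iff]
  intro x X Y Z hX hY hZ
  simp only
  rw [leviCivita_metric I hX hY hZ, torsionConnection_apply, torsionConnection_apply,
    inner_add_left, inner_add_right, inner_smul_left, inner_smul_right,
    real_inner_comm _ (Y x), real_inner_comm _ (Y x), inner_sharp, inner_sharp]
  have := (T x).toAlternatingMap.map_swap ![X x, Y x, Z x] (i := 1) (j := 2) (by decide)
  rw [ContinuousAlternatingMap.coe_toAlternatingMap] at this
  have e : ![X x, Y x, Z x] ∘ Equiv.swap (1 : Fin 3) 2 = ![X x, Z x, Y x] := by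
    ext i
    fin_cases i <;> simp [Equiv.swap_apply_def]
  rw [e] at this
  rw [this, conj_trivial]
  ring

theorem torsionConnection_torsion (T : Π x : M, TangentSpace I x [⋀^Fin 3]→L[ℝ] ℝ) (x : M)
    (u v w : TangentSpace I x) :
    inner ℝ ((torsionConnection I T).torsion x u v) w = T x ![u, v, w] := by
  have h := congr($(leviCivita_torsion I (M := M)) x u v)
  rw [CovariantDerivative.torsion_apply_eq_extend] at h
  rw [CovariantDerivative.torsion_apply_eq_extend, ← inner_sharp]
  congr 1
  rw [torsionConnection_apply, torsionConnection_apply]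
  simp only [extend_apply_self] at h ⊢
  rw [sharp_swap I T x v u]
  replace h := h.trans (show _ = (0 : TangentSpace I x) from rfl)
  rw [← sub_eq_zero, ← h]
  module

/-! ### Curvature -/

/-- The curvature `R(X, Y)Z = D_X D_Y Z - D_Y D_X Z - D_{[X, Y]} Z` on vector fields. -/
def curvatureOnFields (D : CovariantDerivative I E (fun x : M ↦ TangentSpace I x))
    (X Y Z : Π x : M, TangentSpace I x) (x : M) : TangentSpace I x :=
  D (fun y ↦ D Z y (Y y)) x (X x) - D (fun y ↦ D Z y (X y)) x (Y x) - D Z x (mlieBracket I X Y x)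

/-- The curvature tensor `R(u, v)w` at `x`; the tangent vectors are extended to vector fields near
`x` (the value does not depend on the extension). -/
def curvature (D : CovariantDerivative I E (fun x : M ↦ TangentSpace I x)) (x : M)
    (u v w : TangentSpace I x) : TangentSpace I x :=
  curvatureOnFields I D (extend E u) (extend E v) (extend E w) x

/-- The Ricci tensor `Ric(u, v) = ∑ᵢ ⟨R(eᵢ, u)v, eᵢ⟩`. -/
def ricci (D : CovariantDerivative I E (fun x : M ↦ TangentSpace I x)) (x : M)
    (u v : TangentSpace I x) : ℝ :=
  ∑ i, inner ℝ (curvature I D x (frame I x i) u v) (frame I x i)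

/-- The scalar curvature `∑ᵢ Ric(eᵢ, eᵢ)`. -/
def scalarCurvature (D : CovariantDerivative I E (fun x : M ↦ TangentSpace I x)) (x : M) : ℝ :=
  ∑ i, ricci I D x (frame I x i) (frame I x i)

/-- The `∇`-Einstein condition: the symmetric part of the Ricci tensor is a scalar multiple of the
metric, the factor being a function on `M`. -/
def IsNablaEinstein (D : CovariantDerivative I E (fun x : M ↦ TangentSpace I x)) : Prop :=
  ∃ f : M → ℝ, ∀ (x : M) (u v : TangentSpace I x),
    (ricci I D x u v + ricci I D x v u) / 2 = f x * inner ℝ u v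

end

end TorsionGeometry

/-!
The Einstein condition is differentiated in a frame that is orthonormal near a point `x` and
parallel at `x` for `∇ᵍ`. Write `n` for the dimension, `Q_jk = T_jab T_kab` and `S`, `S'` for the
scalar curvatures of `∇ᵍ` and `∇`. The Ricci tensor of `∇` is `Ricᵍ - δT / 2 - Q / 4`, and `δT` is
skew, so `∇` is `∇`-Einstein exactly when `n Ricᵍ = S' g + (n / 4) Q`. Taking divergences, the
contracted Bianchi identity `dS = 2 div Ricᵍ`, the identity `3 div Q = d|T|² / 2 - (3θ + Θ)` and
`|T|² = 4 (S - S')` give `4 n dS + 2 (n - 6) dS' = -n (3θ + Θ)`. Dimension six is thus where `S'`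
drops out.
-/

namespace TorsionGeometry

noncomputable section

variable {E : Type*} [NormedAddCommGroup E] [NormedSpace ℝ E]
  {H : Type*} [TopologicalSpace H] {I : ModelWithCorners ℝ E H}
  {M : Type*} [TopologicalSpace M] [ChartedSpace H M]

section SmoothGerms

variable (I) in
/-- Smoothness of a function on a neighbourhood of `x`. This is stronger than `CMDiffAt ∞ f x`,
whose neighbourhoods of `C^n` regularity may shrink as `n` grows. -/
def SmoothFunNear (x : M) (f : M → ℝ) : Prop := ∀ᶠ y in 𝓝 x, CMDiffAt ∞ f y

variable {ι : Type*} {s : Finset ι} {f g : M → ℝ} {x : M}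

namespace SmoothFunNear

theorem mdiff (hf : SmoothFunNear I x f) : MDiffAt f x :=
  hf.self_of_nhds.mdifferentiableAt (by simp)

theorem eventually (hf : SmoothFunNear I x f) : ∀ᶠ y in 𝓝 x, SmoothFunNear I y f :=
  hf.eventually_nhds

theorem congr (hf : SmoothFunNear I x f) (h : f =ᶠ[𝓝 x] g) : SmoothFunNear I x g := by
  filter_upwards [hf, eventually_eventually_nhds.2 h] with y hy hfg
  exact hy.congr_of_eventuallyEq (hfg.mono fun _ ↦ Eq.symm)

theorem const (c : ℝ) : SmoothFunNear I x fun _ ↦ c := .of_forall fun _ ↦ contMDiffAt_const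

theorem add (hf : SmoothFunNear I x f) (hg : SmoothFunNear I x g) :
    SmoothFunNear I x fun y ↦ f y + g y := by
  filter_upwards [hf, hg] with y hfy hgy using hfy.add hgy

theorem sub (hf : SmoothFunNear I x f) (hg : SmoothFunNear I x g) :
    SmoothFunNear I x fun y ↦ f y - g y := by
  filter_upwards [hf, hg] with y hfy hgy using hfy.sub hgy

theorem mul (hf : SmoothFunNear I x f) (hg : SmoothFunNear I x g) :
    SmoothFunNear I x fun y ↦ f y * g y := by
  filter_upwards [hf, hg] with y hfy hgy using hfy.mul hgy

theorem sum {f : ι → M → ℝ} (hf : ∀ i ∈ s, SmoothFunNear I x (f i)) :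
    SmoothFunNear I x fun y ↦ ∑ i ∈ s, f i y := by
  filter_upwards [(Filter.eventually_all_finset s).2 hf] with y hy
  exact contMDiffAt_finsetSum hy

theorem comp {φ : ℝ → ℝ} (hφ : ∀ᶠ t in 𝓝 (f x), ContDiffAt ℝ ∞ φ t) (hf : SmoothFunNear I x f) :
    SmoothFunNear I x fun y ↦ φ (f y) := by
  filter_upwards [hf, hf.mdiff.continuousAt.eventually hφ] with y hfy hφy
  exact hφy.contMDiffAt.comp y hfy

end SmoothFunNear

variable [IsManifold I ∞ M] {X Y Z : Π x : M, TangentSpace I x}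

/-- Smoothness of a vector field on a neighbourhood of `x`; compare `SmoothFunNear`. -/
def SmoothFieldNear (x : M) (X : Π x : M, TangentSpace I x) : Prop :=
  ∀ᶠ y in 𝓝 x, CMDiffAt ∞ (T% X) y

namespace SmoothFieldNear

theorem mdiff (hX : SmoothFieldNear x X) : MDiffAt (T% X) x :=
  hX.self_of_nhds.mdifferentiableAt (by simp)

theorem eventually (hX : SmoothFieldNear x X) : ∀ᶠ y in 𝓝 x, SmoothFieldNear y X :=
  hX.eventually_nhds

theorem congr (hX : SmoothFieldNear x X) (h : X =ᶠ[𝓝 x] Y) : SmoothFieldNear x Y := by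
  filter_upwards [hX, eventually_eventually_nhds.2 h] with y hy hXY
  exact hy.congr_of_eventuallyEq (hXY.mono fun z hz ↦ by simp only [← hz])

theorem add (hX : SmoothFieldNear x X) (hY : SmoothFieldNear x Y) : SmoothFieldNear x (X + Y) := by
  filter_upwards [hX, hY] with y hXy hYy using hXy.add_section hYy

theorem sub (hX : SmoothFieldNear x X) (hY : SmoothFieldNear x Y) : SmoothFieldNear x (X - Y) := by
  filter_upwards [hX, hY] with y hXy hYy using hXy.sub_section hYy

theorem smul (hf : SmoothFunNear I x f) (hX : SmoothFieldNear x X) :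
    SmoothFieldNear x (f • X) := by
  filter_upwards [hf, hX] with y hfy hXy using hfy.smul_section hXy

theorem sum {X : ι → Π x : M, TangentSpace I x} (hX : ∀ i ∈ s, SmoothFieldNear x (X i)) :
    SmoothFieldNear x (∑ i ∈ s, X i) := by
  filter_upwards [(Filter.eventually_all_finset s).2 hX] with y hy
  convert ContMDiffAt.sum_section hy using 3
  exact Finset.sum_apply _ _ _

theorem mlieBracket [CompleteSpace E] (hX : SmoothFieldNear x X) (hY : SmoothFieldNear x Y) :
    SmoothFieldNear x (mlieBracket I X Y) := by
  have : IsManifold I ((⊤ : ℕ∞) + 1) M := ‹IsManifold I ∞ M›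
  have : IsManifold I (minSmoothness ℝ 2) M := by
    rw [minSmoothness_of_isRCLikeNormedField]; infer_instance
  filter_upwards [hX, hY] with y hXy hYy
  exact ContMDiffAt.mlieBracket_vectorField (m := ⊤) (n := ⊤) hXy hYy
    (by rw [minSmoothness_of_isRCLikeNormedField]; exact le_rfl)

theorem jacobi_mlieBracket [CompleteSpace E] (hX : SmoothFieldNear x X)
    (hY : SmoothFieldNear x Y) (hZ : SmoothFieldNear x Z) :
    VectorField.mlieBracket I X (VectorField.mlieBracket I Y Z) x =
      VectorField.mlieBracket I (VectorField.mlieBracket I X Y) Z x +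
        VectorField.mlieBracket I Y (VectorField.mlieBracket I X Z) x := by
  have : IsManifold I (minSmoothness ℝ 3) M := by
    rw [minSmoothness_of_isRCLikeNormedField]; infer_instance
  have h : (minSmoothness ℝ 2 : WithTop ℕ∞) ≤ ∞ := by
    rw [minSmoothness_of_isRCLikeNormedField]; exact ENat.LEInfty.out
  exact leibniz_identity_mlieBracket_apply (hX.self_of_nhds.of_le h) (hY.self_of_nhds.of_le h)
    (hZ.self_of_nhds.of_le h)

end SmoothFieldNear

theorem smoothFieldNear_extend (v : TangentSpace I x) : SmoothFieldNear x (extend E v) := by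
  set t := trivializationAt E (TangentSpace I) x
  have htx : ∀ᶠ y in 𝓝 x, y ∈ t.baseSet :=
    t.open_baseSet.mem_nhds (mem_baseSet_trivializationAt' x)
  filter_upwards [htx.eventually_nhds] with y hy
  rw [t.contMDiffAt_section_iff hy.self_of_nhds]
  have hconst : CMDiffAt ∞ (fun _ : M ↦ (t ⟨x, v⟩).2) y := contMDiffAt_const
  refine hconst.congr_of_eventuallyEq (hy.mono fun z hz ↦ ?_)
  change (t ⟨z, t.symm z (t ⟨x, v⟩).2⟩).2 = _
  rw [t.apply_mk_symm hz]

end SmoothGerms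

section Differential

variable {ι : Type*} {s : Finset ι} {f g : M → ℝ} {x : M}

theorem mvfderiv_congr (h : f =ᶠ[𝓝 x] g) : d% f x = d% g x := by
  ext v
  simp only [mvfderiv, ContinuousLinearMap.comp_apply]
  rw [h.mfderiv_eq, h.self_of_nhds]

theorem mvfderiv_finsetSum {f : ι → M → ℝ} (hf : ∀ i ∈ s, MDiffAt (f i) x) :
    d% (fun y ↦ ∑ i ∈ s, f i y) x = ∑ i ∈ s, d% (f i) x := by
  classical
  suffices h : MDiffAt (fun y ↦ ∑ i ∈ s, f i y) x ∧
      d% (fun y ↦ ∑ i ∈ s, f i y) x = ∑ i ∈ s, d% (f i) x from h.2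
  induction s using Finset.induction_on with
  | empty => exact ⟨by simpa using mdifferentiableAt_const, by simp [mvfderiv_const]⟩
  | insert a s ha ih =>
    obtain ⟨hfa, hfs⟩ := Finset.forall_mem_insert .. |>.1 hf
    obtain ⟨hs, hds⟩ := ih hfs
    simp only [Finset.sum_insert ha]
    exact ⟨hfa.add hs, by rw [mvfderiv_fun_add hfa hs, hds]⟩

theorem mvfderiv_const_mul (c : ℝ) (hf : MDiffAt f x) :
    d% (fun y ↦ c * f y) x = c • d% f x := by
  rw [mvfderiv_fun_mul mdifferentiableAt_const hf, mvfderiv_const, smul_zero, add_zero]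

end Differential

section SecondDerivative

variable [IsManifold I ∞ M] {f : M → ℝ} {X Y : Π x : M, TangentSpace I x} {x : M}

theorem SmoothFunNear.mvfderiv_apply (hf : SmoothFunNear I x f) (hX : SmoothFieldNear x X) :
    SmoothFunNear I x fun y ↦ d% f y (X y) := by
  obtain ⟨U, hU, hUo, hxU⟩ := eventually_nhds_iff.1 (hf.and hX)
  have hdf : ContMDiffOn I.tangent 𝓘(ℝ, ℝ).tangent ∞ (tangentMapWithin I 𝓘(ℝ, ℝ) f U)
      (π E (TangentSpace I) ⁻¹' U) :=
    ContMDiffOn.contMDiffOn_tangentMapWithin (n := ∞) (fun y hy ↦ (hU y hy).1.contMDiffWithinAt)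
      (by simp) hUo.uniqueMDiffOn
  have hdfX := (contMDiff_snd_tangentBundle_modelSpace ℝ 𝓘(ℝ, ℝ)).comp_contMDiffOn
    (hdf.comp (fun y hy ↦ (hU y hy).2.contMDiffWithinAt) fun y hy ↦ hy)
  filter_upwards [hUo.mem_nhds hxU] with y hy
  refine (hdfX.contMDiffAt (hUo.mem_nhds hy)).congr_of_eventuallyEq ?_
  filter_upwards [hUo.mem_nhds hy] with z hz
  change mvfderiv I f z (X z) = mfderivWithin I 𝓘(ℝ, ℝ) f U z (X z)
  rw [mfderivWithin_of_isOpen hUo hz]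
  rfl

/-- The field `Z` only serves to read off the identity between functions from the Jacobi identity
for `X`, `Y` and `f • Z`. -/
theorem SmoothFunNear.mvfderiv_mlieBracket [CompleteSpace E] (hf : SmoothFunNear I x f)
    (hX : SmoothFieldNear x X) (hY : SmoothFieldNear x Y) :
    d% f x (mlieBracket I X Y x) =
      d% (fun y ↦ d% f y (Y y)) x (X x) - d% (fun y ↦ d% f y (X y)) x (Y x) := by
  rcases subsingleton_or_nontrivial (TangentSpace I x) with hE | hE
  · rw [Subsingleton.elim (X x) 0, Subsingleton.elim (Y x) 0,
      Subsingleton.elim (mlieBracket I X Y x) 0]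
    simp only [map_zero, sub_zero]
  obtain ⟨v, hv⟩ := exists_ne (0 : TangentSpace I x)
  set Z : Π x : M, TangentSpace I x := extend E v
  have hZ : SmoothFieldNear x Z := smoothFieldNear_extend v
  have smul_right {W : Π x : M, TangentSpace I x} :
      mlieBracket I W (f • Z) =ᶠ[𝓝 x] (fun y ↦ d% f y (W y)) • Z + f • mlieBracket I W Z := by
    filter_upwards [hf.eventually, hZ.eventually] with y hfy hZy
    exact mlieBracket_smul_right hfy.mdiff hZy.mdiff
  have second {V W : Π x : M, TangentSpace I x}
      (hW : SmoothFieldNear x W) : mlieBracket I V (mlieBracket I W (f • Z)) x =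
        d% (fun y ↦ d% f y (W y)) x (V x) • Z x + d% f x (W x) • mlieBracket I V Z x +
          (d% f x (V x) • mlieBracket I W Z x + f x • mlieBracket I V (mlieBracket I W Z) x) := by
    have hWf := hf.mvfderiv_apply hW
    have hWZ := hW.mlieBracket hZ
    refine (Filter.EventuallyEq.rfl.mlieBracket_vectorField_eq smul_right).trans ?_
    rw [mlieBracket_add_right (hZ.smul hWf).mdiff (hWZ.smul hf).mdiff,
      mlieBracket_smul_right hWf.mdiff hZ.mdiff, mlieBracket_smul_right hf.mdiff hWZ.mdiff]
  have jacobi := hX.jacobi_mlieBracket hY (hZ.smul hf)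
  rw [second hY, second hX, mlieBracket_smul_right hf.mdiff hZ.mdiff,
    hX.jacobi_mlieBracket hY hZ] at jacobi
  have key : (d% f x (mlieBracket I X Y x) - (d% (fun y ↦ d% f y (Y y)) x (X x) -
      d% (fun y ↦ d% f y (X y)) x (Y x))) • Z x = 0 := by
    rw [eq_comm, ← sub_eq_zero] at jacobi
    refine Eq.trans ?_ jacobi
    module
  have hZx : Z x ≠ 0 := by simpa [Z] using hv
  exact sub_eq_zero.1 ((smul_eq_zero.1 key).resolve_right hZx)

end SecondDerivative

section Tensoriality

variable [IsManifold I ∞ M] {A : Type*} [AddCommGroup A] [Module ℝ A] {x : M}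
  {Φ : (Π x : M, TangentSpace I x) → A} {X Y : Π x : M, TangentSpace I x}

/-- An operation on vector fields that is additive and homogeneous over functions on the fields
smooth near `x`. In contrast to `TensorialAt`, nothing is required of fields that are merely
differentiable, so that operations involving second derivatives are covered. -/
structure SmoothTensorialAt (x : M) (Φ : (Π x : M, TangentSpace I x) → A) : Prop where
  smul : ∀ {f : M → ℝ} {X : Π x : M, TangentSpace I x}, SmoothFunNear I x f →
    SmoothFieldNear x X → Φ (f • X) = f x • Φ X
  add : ∀ {X Y : Π x : M, TangentSpace I x}, SmoothFieldNear x X → SmoothFieldNear x Y →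
    Φ (X + Y) = Φ X + Φ Y

namespace SmoothTensorialAt

theorem congr (hΦ : SmoothTensorialAt x Φ) (hX : SmoothFieldNear x X) (hY : SmoothFieldNear x Y)
    (h : X =ᶠ[𝓝 x] Y) : Φ X = Φ Y := by
  classical
  let ψ : M → ℝ := fun y ↦ if X y = Y y then 1 else 0
  have hψ : SmoothFunNear I x ψ :=
    (SmoothFunNear.const 1).congr (h.mono fun y hy ↦ by simp [ψ, hy])
  have hψx : ψ x = 1 := by simp [ψ, h.self_of_nhds]
  have hψXY : ψ • X = ψ • Y := by
    ext1 y
    by_cases hy : X y = Y y <;> simp [ψ, hy]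
  rw [← one_smul ℝ (Φ X), ← one_smul ℝ (Φ Y), ← hψx, ← hΦ.smul hψ hX, ← hΦ.smul hψ hY, hψXY]

theorem sum (hΦ : SmoothTensorialAt x Φ) {ι : Type*} {s : Finset ι}
    {X : ι → Π x : M, TangentSpace I x} (hX : ∀ i ∈ s, SmoothFieldNear x (X i)) :
    Φ (∑ i ∈ s, X i) = ∑ i ∈ s, Φ (X i) := by
  classical
  induction s using Finset.induction_on with
  | empty =>
    have h := hΦ.smul (SmoothFunNear.const 0) (smoothFieldNear_extend (0 : TangentSpace I x))
    rw [zero_smul] at h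
    rw [Finset.sum_empty, Finset.sum_empty, ← h]
    congr 1
    ext1 y
    exact (zero_smul ℝ _).symm
  | insert a s ha ih =>
    obtain ⟨hXa, hXs⟩ := Finset.forall_mem_insert .. |>.1 hX
    rw [Finset.sum_insert ha, Finset.sum_insert ha, hΦ.add hXa (.sum hXs), ih hXs]

theorem pointwise [FiniteDimensional ℝ E] (hΦ : SmoothTensorialAt x Φ) (hX : SmoothFieldNear x X)
    (hY : SmoothFieldNear x Y) (h : X x = Y x) : Φ X = Φ Y := by
  let t := trivializationAt E (TangentSpace I) x
  have hxt : x ∈ t.baseSet := mem_baseSet_trivializationAt E (TangentSpace I) x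
  let b := Module.finBasis ℝ E
  let c (i) (Z : Π x : M, TangentSpace I x) : M → ℝ := fun y ↦ t.localFrameCoeff I b i y (Z y)
  have : IsManifold I 1 M := .of_le (n := ∞) (by simp)
  have : ContMDiffVectorBundle ∞ E (TangentSpace I : M → Type _) I :=
    have : IsManifold I (∞ + 1) M := ‹IsManifold I ∞ M›
    TangentBundle.contMDiffVectorBundle
  have hs (i) : SmoothFieldNear x (t.localFrame b i) := by
    filter_upwards [t.open_baseSet.mem_nhds hxt] with y hy
    exact contMDiffAt_localFrame_of_mem _ _ b i hy
  have hc (i) {Z : Π x : M, TangentSpace I x} (hZ : SmoothFieldNear x Z) :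
      SmoothFunNear I x (c i Z) := by
    filter_upwards [t.open_baseSet.mem_nhds hxt, hZ] with y hy hZy
    exact contMDiffAt_localFrameCoeff b hy hZy i
  have expand {Z : Π x : M, TangentSpace I x} (hZ : SmoothFieldNear x Z) :
      Φ Z = ∑ i, c i Z x • Φ (t.localFrame b i) := by
    have hcs (i) (_ : i ∈ Finset.univ) := (hs i).smul (hc i hZ)
    rw [hΦ.congr hZ (.sum hcs), hΦ.sum hcs]
    · exact Finset.sum_congr rfl fun i _ ↦ hΦ.smul (hc i hZ) (hs i)
    · filter_upwards [t.eventually_eq_localFrame_sum_coeff_smul b hxt (s := Z) (I := I)] with y hy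
      rw [hy, Finset.sum_apply]
      rfl
  rw [expand hX, expand hY]
  simp only [c, h]

theorem isLinearMap [FiniteDimensional ℝ E] (hΦ : SmoothTensorialAt x Φ) :
    IsLinearMap ℝ fun v : TangentSpace I x ↦ Φ (extend E v) where
  map_add v w := by
    have hv := smoothFieldNear_extend v
    have hw := smoothFieldNear_extend w
    rw [← hΦ.add hv hw]
    exact hΦ.pointwise (smoothFieldNear_extend _) (hv.add hw) (by simp)
  map_smul c v := by
    have hv := smoothFieldNear_extend v
    have hc : SmoothFunNear I x fun _ ↦ c := .const c
    rw [← hΦ.smul hc hv]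
    exact hΦ.pointwise (smoothFieldNear_extend _) (hv.smul hc) (by simp)

end SmoothTensorialAt

end Tensoriality

section Connection

variable [IsManifold I ∞ M] {D : CovariantDerivative I E (fun x : M ↦ TangentSpace I x)}
  {f : M → ℝ} {X Y : Π x : M, TangentSpace I x} {x : M}

theorem conn_congr (hX : SmoothFieldNear x X) (h : X =ᶠ[𝓝 x] Y) : D X x = D Y x :=
  (D.isCovariantDerivativeOn (s := Set.univ)).congr_of_eventuallyEq hX.mdiff (hX.congr h).mdiff
    Filter.univ_mem h

theorem conn_add (hX : SmoothFieldNear x X) (hY : SmoothFieldNear x Y) :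
    D (X + Y) x = D X x + D Y x :=
  (D.isCovariantDerivativeOn (s := Set.univ)).add hX.mdiff hY.mdiff

theorem conn_sub (hX : SmoothFieldNear x X) (hY : SmoothFieldNear x Y) :
    D (X - Y) x = D X x - D Y x := by
  rw [eq_sub_iff_add_eq, ← conn_add (hX.sub hY) hY, sub_add_cancel]

theorem conn_smul (hf : SmoothFunNear I x f) (hX : SmoothFieldNear x X) (v : TangentSpace I x) :
    D (f • X) x v = f x • D X x v + d% f x v • X x := by
  rw [(D.isCovariantDerivativeOn (s := Set.univ)).leibniz hX.mdiff hf.mdiff]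
  rfl

theorem conn_sum {ι : Type*} {s : Finset ι} {X : ι → Π x : M, TangentSpace I x}
    (hX : ∀ i ∈ s, SmoothFieldNear x (X i)) : D (∑ i ∈ s, X i) x = ∑ i ∈ s, D (X i) x := by
  classical
  induction s using Finset.induction_on with
  | empty => exact congrFun D.zero x
  | insert a s ha ih =>
    obtain ⟨hXa, hXs⟩ := Finset.forall_mem_insert .. |>.1 hX
    rw [Finset.sum_insert ha, Finset.sum_insert ha, conn_add hXa (.sum hXs), ih hXs]

theorem conn_sub_conn_of_torsion_eq_zero [FiniteDimensional ℝ E] (hD : D.torsion = 0)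
    (hX : SmoothFieldNear x X) (hY : SmoothFieldNear x Y) :
    D Y x (X x) - D X x (Y x) = mlieBracket I X Y x :=
  (CovariantDerivative.torsion_eq_zero_iff D).1 hD hX.mdiff hY.mdiff

/-- Smoothness of a connection: the covariant derivative of a smooth field along a smooth field is
smooth. -/
def SmoothConn (D : CovariantDerivative I E (fun x : M ↦ TangentSpace I x)) : Prop :=
  ∀ ⦃x : M⦄ ⦃X Y : Π x : M, TangentSpace I x⦄, SmoothFieldNear x X → SmoothFieldNear x Y →
    SmoothFieldNear x fun y ↦ D Y y (X y)

end Connection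

section Curvature

variable [IsManifold I ∞ M] {D : CovariantDerivative I E (fun x : M ↦ TangentSpace I x)}
  {f : M → ℝ} {X Y Z : Π x : M, TangentSpace I x} {x : M}

theorem curvatureOnFields_swap (X Y Z : Π x : M, TangentSpace I x) (x : M) :
    curvatureOnFields I D X Y Z x = -curvatureOnFields I D Y X Z x := by
  simp only [curvatureOnFields]
  rw [mlieBracket_swap_apply, map_neg]
  abel

theorem curvature_swap (u v w : TangentSpace I x) :
    curvature I D x u v w = -curvature I D x v u w :=
  curvatureOnFields_swap ..

theorem smoothTensorialAt_curvatureOnFields_left [CompleteSpace E] (hD : SmoothConn D)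
    (Y : Π x : M, TangentSpace I x) (hZ : SmoothFieldNear x Z) :
    SmoothTensorialAt x fun X ↦ curvatureOnFields I D X Y Z x where
  add {X X'} hX hX' := by
    have h : (fun y ↦ D Z y ((X + X') y)) = (fun y ↦ D Z y (X y)) + fun y ↦ D Z y (X' y) := by
      ext1 y; exact map_add ..
    simp only [curvatureOnFields]
    rw [h, conn_add (hD hX hZ) (hD hX' hZ), mlieBracket_add_left hX.mdiff hX'.mdiff]
    simp only [map_add, Pi.add_apply, _root_.add_apply]
    abel
  smul {f X} hf hX := by
    have h : (fun y ↦ D Z y ((f • X) y)) = f • fun y ↦ D Z y (X y) := by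
      ext1 y; exact map_smul ..
    simp only [curvatureOnFields]
    rw [h, conn_smul hf (hD hX hZ), mlieBracket_smul_left hf.mdiff hX.mdiff]
    simp only [map_add, map_smul, Pi.smul_apply', neg_smul, map_neg]
    module

theorem SmoothConn.conn_conn_add (hD : SmoothConn D) {Z' : Π x : M, TangentSpace I x}
    (hX : SmoothFieldNear x X) (hZ : SmoothFieldNear x Z) (hZ' : SmoothFieldNear x Z') :
    D (fun y ↦ D (Z + Z') y (X y)) x =
      D (fun y ↦ D Z y (X y)) x + D (fun y ↦ D Z' y (X y)) x := by
  rw [← conn_add (hD hX hZ) (hD hX hZ')]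
  refine conn_congr (hD hX (hZ.add hZ')) ?_
  filter_upwards [hZ.eventually, hZ'.eventually] with y hy hy'
  rw [conn_add hy hy']
  rfl

theorem SmoothConn.conn_conn_smul (hD : SmoothConn D) (hf : SmoothFunNear I x f)
    (hX : SmoothFieldNear x X) (hZ : SmoothFieldNear x Z) (v : TangentSpace I x) :
    D (fun y ↦ D (f • Z) y (X y)) x v =
      f x • D (fun y ↦ D Z y (X y)) x v + d% f x v • D Z x (X x) +
        (d% f x (X x) • D Z x v + d% (fun y ↦ d% f y (X y)) x v • Z x) := by
  have hXf := hf.mvfderiv_apply hX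
  rw [← conn_smul hf (hD hX hZ), ← conn_smul hXf hZ, ← _root_.add_apply,
    ← conn_add ((hD hX hZ).smul hf) (hZ.smul hXf)]
  refine congrArg (fun L ↦ L v) (conn_congr (hD hX (hZ.smul hf)) ?_)
  filter_upwards [hf.eventually, hZ.eventually] with y hfy hZy
  rw [conn_smul hfy hZy]
  rfl

theorem smoothTensorialAt_curvatureOnFields_right [CompleteSpace E] (hD : SmoothConn D)
    (hX : SmoothFieldNear x X) (hY : SmoothFieldNear x Y) :
    SmoothTensorialAt x fun Z ↦ curvatureOnFields I D X Y Z x where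
  add hZ hZ' := by
    simp only [curvatureOnFields]
    rw [hD.conn_conn_add hX hZ hZ', hD.conn_conn_add hY hZ hZ', conn_add hZ hZ']
    simp only [_root_.add_apply]
    abel
  smul hf hZ := by
    simp only [curvatureOnFields]
    rw [hD.conn_conn_smul hf hX hZ, hD.conn_conn_smul hf hY hZ, conn_smul hf hZ,
      hf.mvfderiv_mlieBracket hX hY]
    module

variable [FiniteDimensional ℝ E]

theorem curvature_apply_fields (hD : SmoothConn D) (hX : SmoothFieldNear x X)
    (hY : SmoothFieldNear x Y) (hZ : SmoothFieldNear x Z) :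
    curvature I D x (X x) (Y x) (Z x) = curvatureOnFields I D X Y Z x := by
  have hX' := smoothFieldNear_extend (X x)
  have hY' := smoothFieldNear_extend (Y x)
  have hZ' := smoothFieldNear_extend (Z x)
  calc curvature I D x (X x) (Y x) (Z x)
      = curvatureOnFields I D X (extend E (Y x)) (extend E (Z x)) x :=
        (smoothTensorialAt_curvatureOnFields_left hD _ hZ').pointwise hX' hX (by simp)
    _ = -curvatureOnFields I D (extend E (Y x)) X (extend E (Z x)) x := curvatureOnFields_swap ..
    _ = -curvatureOnFields I D Y X (extend E (Z x)) x := congrArg Neg.neg <|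
        (smoothTensorialAt_curvatureOnFields_left hD _ hZ').pointwise hY' hY (by simp)
    _ = curvatureOnFields I D X Y (extend E (Z x)) x := (curvatureOnFields_swap ..).symm
    _ = curvatureOnFields I D X Y Z x :=
        (smoothTensorialAt_curvatureOnFields_right hD hX hY).pointwise hZ' hZ (by simp)

theorem isLinearMap_curvature_left (hD : SmoothConn D) (v w : TangentSpace I x) :
    IsLinearMap ℝ fun u ↦ curvature I D x u v w :=
  (smoothTensorialAt_curvatureOnFields_left hD _ (smoothFieldNear_extend w)).isLinearMap

theorem isLinearMap_curvature_middle (hD : SmoothConn D) (u w : TangentSpace I x) :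
    IsLinearMap ℝ fun v ↦ curvature I D x u v w := by
  simp_rw [curvature_swap u]
  exact (-(isLinearMap_curvature_left hD u w).mk' _).isLinear

theorem isLinearMap_curvature_right (hD : SmoothConn D) (u v : TangentSpace I x) :
    IsLinearMap ℝ fun w ↦ curvature I D x u v w :=
  (smoothTensorialAt_curvatureOnFields_right hD (smoothFieldNear_extend u)
    (smoothFieldNear_extend v)).isLinearMap

end Curvature

section Bianchi

variable [IsManifold I ∞ M] {D : CovariantDerivative I E (fun x : M ↦ TangentSpace I x)}
  {X Y Z W : Π x : M, TangentSpace I x} {x : M}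

/-- The field `X` is smooth near `x` and its covariant derivative vanishes at the point `x`. -/
structure ParallelAt (D : CovariantDerivative I E (fun x : M ↦ TangentSpace I x)) (x : M)
    (X : Π x : M, TangentSpace I x) : Prop where
  smooth : SmoothFieldNear x X
  conn_eq_zero : D X x = 0

theorem SmoothConn.smooth_curvatureOnFields [CompleteSpace E] (hD : SmoothConn D)
    (hX : SmoothFieldNear x X) (hY : SmoothFieldNear x Y) (hZ : SmoothFieldNear x Z) :
    SmoothFieldNear x (curvatureOnFields I D X Y Z) :=
  ((hD hX (hD hY hZ)).sub (hD hY (hD hX hZ))).sub (hD (hX.mlieBracket hY) hZ)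

variable [FiniteDimensional ℝ E]

theorem SmoothConn.curvatureOnFields_eq_zero_of_left (hD : SmoothConn D)
    (hX : SmoothFieldNear x X) (hY : SmoothFieldNear x Y) (hZ : SmoothFieldNear x Z)
    (hXx : X x = 0) : curvatureOnFields I D X Y Z x = 0 := by
  rw [← curvature_apply_fields hD hX hY hZ, hXx]
  exact (isLinearMap_curvature_left hD _ _).map_zero

theorem SmoothConn.curvatureOnFields_eq_zero_of_right (hD : SmoothConn D)
    (hX : SmoothFieldNear x X) (hY : SmoothFieldNear x Y) (hZ : SmoothFieldNear x Z)
    (hZx : Z x = 0) : curvatureOnFields I D X Y Z x = 0 := by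
  rw [← curvature_apply_fields hD hX hY hZ, hZx]
  exact (isLinearMap_curvature_right hD _ _).map_zero

theorem SmoothConn.conn_conn_of_apply_eq_zero (hD : SmoothConn D) (hX : SmoothFieldNear x X)
    (hY : SmoothFieldNear x Y) (hZ : SmoothFieldNear x Z) (hXx : X x = 0) :
    D (fun y ↦ D Z y (X y)) x (Y x) = -D Z x (mlieBracket I X Y x) := by
  have h := hD.curvatureOnFields_eq_zero_of_left hX hY hZ hXx
  rw [curvatureOnFields, hXx, map_zero, zero_sub, ← neg_add', neg_eq_zero] at h
  exact eq_neg_of_add_eq_zero_left h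

theorem first_bianchi (hD : SmoothConn D) (hD₀ : D.torsion = 0) (hX : SmoothFieldNear x X)
    (hY : SmoothFieldNear x Y) (hZ : SmoothFieldNear x Z) :
    curvatureOnFields I D X Y Z x + curvatureOnFields I D Y Z X x +
      curvatureOnFields I D Z X Y x = 0 := by
  have conn_bracket {X Y Z : Π x : M, TangentSpace I x} (hX : SmoothFieldNear x X)
      (hY : SmoothFieldNear x Y) (hZ : SmoothFieldNear x Z) :
      D (fun y ↦ D Z y (Y y)) x (X x) - D (fun y ↦ D Y y (Z y)) x (X x) -
        D X x (mlieBracket I Y Z x) = mlieBracket I X (mlieBracket I Y Z) x := by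
    have h : D (fun y ↦ D Z y (Y y)) x - D (fun y ↦ D Y y (Z y)) x = D (mlieBracket I Y Z) x := by
      rw [← conn_sub (hD hY hZ) (hD hZ hY)]
      refine conn_congr ((hD hY hZ).sub (hD hZ hY)) ?_
      filter_upwards [hY.eventually, hZ.eventually] with y hYy hZy
      exact conn_sub_conn_of_torsion_eq_zero hD₀ hYy hZy
    rw [← _root_.sub_apply, h, conn_sub_conn_of_torsion_eq_zero hD₀ hX (hY.mlieBracket hZ)]
  calc _ = mlieBracket I X (mlieBracket I Y Z) x - mlieBracket I Y (mlieBracket I X Z) x -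
        mlieBracket I (mlieBracket I X Y) Z x := by
        rw [mlieBracket_swap_apply (V := mlieBracket I X Y), ← conn_bracket hX hY hZ,
          ← conn_bracket hY hX hZ, ← conn_bracket hZ hX hY]
        simp only [curvatureOnFields, mlieBracket_swap_apply (V := Z) (W := X), map_neg]
        abel
    _ = 0 := by
        rw [hX.jacobi_mlieBracket hY hZ]
        abel

theorem curvature_bianchi (hD : SmoothConn D) (hD₀ : D.torsion = 0) (u v w : TangentSpace I x) :
    curvature I D x u v w + curvature I D x v w u + curvature I D x w u v = 0 :=
  first_bianchi hD hD₀ (smoothFieldNear_extend u) (smoothFieldNear_extend v)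
    (smoothFieldNear_extend w)

theorem ParallelAt.mlieBracket_eq_zero (hD₀ : D.torsion = 0) (hX : ParallelAt D x X)
    (hY : ParallelAt D x Y) : mlieBracket I X Y x = 0 := by
  rw [← conn_sub_conn_of_torsion_eq_zero hD₀ hX.smooth hY.smooth, hX.conn_eq_zero, hY.conn_eq_zero]
  exact sub_self _

theorem conn_conn_conn_comm (hD : SmoothConn D) (hD₀ : D.torsion = 0) (hX : ParallelAt D x X)
    (hY : ParallelAt D x Y) (hZ : SmoothFieldNear x Z) (hW : ParallelAt D x W) :
    D (fun y ↦ D (fun y ↦ D W y (Z y)) y (Y y)) x (X x) =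
      D (fun y ↦ D (fun y ↦ D W y (Z y)) y (X y)) x (Y x) := by
  have h := hD.curvatureOnFields_eq_zero_of_right hX.smooth hY.smooth (hD hZ hW.smooth)
    (by rw [hW.conn_eq_zero]; rfl)
  rwa [curvatureOnFields, hX.mlieBracket_eq_zero hD₀ hY, map_zero, sub_zero, sub_eq_zero] at h

theorem conn_curvatureOnFields (hD : SmoothConn D) (hD₀ : D.torsion = 0) (hX : ParallelAt D x X)
    (hY : ParallelAt D x Y) (hZ : SmoothFieldNear x Z) (hW : ParallelAt D x W) :
    D (curvatureOnFields I D X Y W) x (Z x) =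
      D (fun y ↦ D (fun y ↦ D W y (Y y)) y (X y)) x (Z x) -
        D (fun y ↦ D (fun y ↦ D W y (X y)) y (Y y)) x (Z x) := by
  have hXY := hX.smooth.mlieBracket hY.smooth
  have hXYW := hD hX.smooth (hD hY.smooth hW.smooth)
  have hYXW := hD hY.smooth (hD hX.smooth hW.smooth)
  have bracket_term : D (fun y ↦ D W y (mlieBracket I X Y y)) x (Z x) = 0 := by
    rw [hD.conn_conn_of_apply_eq_zero hXY hZ hW.smooth (hX.mlieBracket_eq_zero hD₀ hY),
      hW.conn_eq_zero]
    exact neg_zero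
  have expand : D (curvatureOnFields I D X Y W) x =
      D (fun y ↦ D (fun y ↦ D W y (Y y)) y (X y)) x -
        D (fun y ↦ D (fun y ↦ D W y (X y)) y (Y y)) x -
          D (fun y ↦ D W y (mlieBracket I X Y y)) x := by
    rw [← conn_sub hXYW hYXW, ← conn_sub (hXYW.sub hYXW) (hD hXY hW.smooth)]
    rfl
  rw [expand, _root_.sub_apply, _root_.sub_apply, bracket_term, sub_zero]

theorem second_bianchi (hD : SmoothConn D) (hD₀ : D.torsion = 0) (hX : ParallelAt D x X)
    (hY : ParallelAt D x Y) (hZ : ParallelAt D x Z) (hW : ParallelAt D x W) :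
    D (curvatureOnFields I D X Y W) x (Z x) + D (curvatureOnFields I D Y Z W) x (X x) +
      D (curvatureOnFields I D Z X W) x (Y x) = 0 := by
  rw [conn_curvatureOnFields hD hD₀ hX hY hZ.smooth hW,
    conn_curvatureOnFields hD hD₀ hY hZ hX.smooth hW,
    conn_curvatureOnFields hD hD₀ hZ hX hY.smooth hW,
    conn_conn_conn_comm hD hD₀ hZ hX hY.smooth hW, conn_conn_conn_comm hD hD₀ hX hY hZ.smooth hW,
    conn_conn_conn_comm hD hD₀ hY hZ hX.smooth hW]
  abel

end Bianchi

section CriticalFunctions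

variable {f g : M → ℝ} {x : M}

variable (I) in
/-- The function `f` is smooth near `x` and its differential vanishes at the point `x`. -/
structure CriticalAt (x : M) (f : M → ℝ) : Prop where
  smooth : SmoothFunNear I x f
  mvfderiv_eq_zero : d% f x = 0

theorem CriticalAt.mul (hf : CriticalAt I x f) (hg : CriticalAt I x g) :
    CriticalAt I x (fun y ↦ f y * g y) where
  smooth := hf.smooth.mul hg.smooth
  mvfderiv_eq_zero := by
    rw [mvfderiv_fun_mul hf.smooth.mdiff hg.smooth.mdiff, hf.mvfderiv_eq_zero, hg.mvfderiv_eq_zero]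
    simp

theorem CriticalAt.comp {φ : ℝ → ℝ} (hφ : ∀ᶠ t in 𝓝 (f x), ContDiffAt ℝ ∞ φ t)
    (hf : CriticalAt I x f) : CriticalAt I x (fun y ↦ φ (f y)) where
  smooth := .comp hφ hf.smooth
  mvfderiv_eq_zero := by
    ext v
    have hφx : MDiffAt φ (f x) := hφ.self_of_nhds.contMDiffAt.mdifferentiableAt (by simp)
    have hfv : mfderiv% f x v = 0 := by
      have := congrArg (fun L ↦ L v) hf.mvfderiv_eq_zero
      simpa [mvfderiv] using this
    exact (mvfderiv_comp_apply x hφx hf.smooth.mdiff v).trans (by rw [hfv, map_zero]; rfl)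

variable (I) in
theorem exists_smoothFunNear_mvfderiv_eq [IsManifold I ∞ M] (x : M)
    (L : TangentSpace I x →L[ℝ] ℝ) :
    ∃ f : M → ℝ, SmoothFunNear I x f ∧ f x = 0 ∧ d% f x = L := by
  have : IsManifold I 1 M := .of_le (n := ∞) (by simp)
  obtain ⟨e, he⟩ := isInvertible_mfderiv_extChartAt (I := I) (mem_extChartAt_source x)
  have chart_smooth : ∀ᶠ y in 𝓝 x, ContMDiffAt I 𝓘(ℝ, E) ∞ (extChartAt I x) y := by
    filter_upwards [(chartAt H x).open_source.mem_nhds (mem_chart_source H x)] with y hy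
    exact contMDiffAt_extChartAt' hy
  let L' : E →L[ℝ] ℝ := L ∘L
    (e.symm : TangentSpace 𝓘(ℝ, E) (extChartAt I x x) →L[ℝ] TangentSpace I x)
  let φ : E → ℝ := fun z ↦ L' z - L' (extChartAt I x x)
  have hφ : ContDiff ℝ ∞ φ := L'.contDiff.sub contDiff_const
  have hdφ : fderiv ℝ φ (extChartAt I x x) = L' := by
    simp only [φ]
    rw [fderiv_sub_const, L'.fderiv]
  refine ⟨fun y ↦ φ (extChartAt I x y), ?_, by simp [φ], ?_⟩
  · filter_upwards [chart_smooth] with y hy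
    exact hφ.contDiffAt.contMDiffAt.comp y hy
  · ext v
    refine (mvfderiv_comp_apply x (hφ.contDiffAt.contMDiffAt.mdifferentiableAt (by simp))
      (chart_smooth.self_of_nhds.mdifferentiableAt (by simp)) v).trans ?_
    rw [← he]
    simp only [mvfderiv, mfderiv_eq_fderiv]
    change fderiv ℝ φ (extChartAt I x x) (e v) = L v
    rw [hdφ]
    exact congrArg L (e.symm_apply_apply v)

end CriticalFunctions

section ParallelFields

variable [IsManifold I ∞ M] {D : CovariantDerivative I E (fun x : M ↦ TangentSpace I x)}
  {f : M → ℝ} {X Y Z : Π x : M, TangentSpace I x} {x : M} {ι : Type*}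

theorem ParallelAt.sub (hX : ParallelAt D x X) (hY : ParallelAt D x Y) :
    ParallelAt D x (X - Y) where
  smooth := hX.smooth.sub hY.smooth
  conn_eq_zero := by
    rw [conn_sub hX.smooth hY.smooth, hX.conn_eq_zero, hY.conn_eq_zero, sub_zero]

theorem ParallelAt.smul (hf : CriticalAt I x f) (hX : ParallelAt D x X) :
    ParallelAt D x (f • X) where
  smooth := hX.smooth.smul hf.smooth
  conn_eq_zero := by
    ext v
    rw [conn_smul hf.smooth hX.smooth, hX.conn_eq_zero, hf.mvfderiv_eq_zero]
    simp

theorem ParallelAt.sum {s : Finset ι} {X : ι → Π x : M, TangentSpace I x}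
    (hX : ∀ i ∈ s, ParallelAt D x (X i)) : ParallelAt D x (∑ i ∈ s, X i) where
  smooth := .sum fun i hi ↦ (hX i hi).smooth
  conn_eq_zero := by
    rw [conn_sum fun i hi ↦ (hX i hi).smooth]
    exact Finset.sum_eq_zero fun i hi ↦ (hX i hi).conn_eq_zero

variable (D) in
theorem exists_parallelAt [FiniteDimensional ℝ E] (v : TangentSpace I x) :
    ∃ X : Π x : M, TangentSpace I x, ParallelAt D x X ∧ X x = v := by
  have : T2Space (TangentSpace I x) := inferInstanceAs (T2Space E)
  let b := Module.finBasis ℝ (TangentSpace I x)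
  let c (j) : TangentSpace I x →L[ℝ] ℝ :=
    LinearMap.toContinuousLinearMap (b.coord j ∘ₗ (D (extend E v) x).toLinearMap)
  choose φ φ_smooth φ_x dφ using fun j ↦ exists_smoothFunNear_mvfderiv_eq I x (c j)
  let correction : Π x : M, TangentSpace I x := ∑ j, φ j • extend E (b j)
  have smooth_summand (j) (_ : j ∈ Finset.univ) : SmoothFieldNear x (φ j • extend E (b j)) :=
    (smoothFieldNear_extend (b j)).smul (φ_smooth j)
  have conn_correction : D correction x = D (extend E v) x := by
    ext w
    rw [conn_sum smooth_summand, _root_.sum_apply]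
    refine Eq.trans (Finset.sum_congr rfl fun j _ ↦ ?_) (b.sum_repr (D (extend E v) x w))
    rw [conn_smul (φ_smooth j) (smoothFieldNear_extend (b j)), φ_x, dφ, zero_smul, zero_add,
      extend_apply_self]
    rfl
  refine ⟨extend E v - correction, ⟨(smoothFieldNear_extend v).sub (.sum smooth_summand), ?_⟩, ?_⟩
  · rw [conn_sub (smoothFieldNear_extend v) (.sum smooth_summand), conn_correction, sub_self]
  · simp [correction, φ_x]

variable [RiemannianBundle (fun x : M ↦ TangentSpace I x)]
  [IsContMDiffRiemannianBundle I ∞ E (fun x : M ↦ TangentSpace I x)]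

theorem SmoothFieldNear.inner (hX : SmoothFieldNear x X) (hY : SmoothFieldNear x Y) :
    SmoothFunNear I x (fun y ↦ inner ℝ (X y) (Y y)) := by
  filter_upwards [hX, hY] with y hXy hYy
  exact ContMDiffAt.inner_bundle (E := fun x : M ↦ TangentSpace I x) (F := E) hXy hYy

variable [FiniteDimensional ℝ E]

theorem conn_inner (hm : D.IsMetricCompatible (V := fun x : M ↦ TangentSpace I x))
    (hY : SmoothFieldNear x Y) (hZ : SmoothFieldNear x Z) (u : TangentSpace I x) :
    d% (fun z ↦ inner ℝ (Y z) (Z z)) x u = inner ℝ (D Y x u) (Z x) + inner ℝ (Y x) (D Z x u) := by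
  rw [CovariantDerivative.isMetricCompatible_iff] at hm
  simpa only [extend_apply_self] using hm (mdifferentiableAt_extend I E u) hY.mdiff hZ.mdiff

theorem ParallelAt.inner (hm : D.IsMetricCompatible (V := fun x : M ↦ TangentSpace I x))
    (hX : ParallelAt D x X) (hY : ParallelAt D x Y) :
    CriticalAt I x (fun y ↦ inner ℝ (X y) (Y y)) where
  smooth := hX.smooth.inner hY.smooth
  mvfderiv_eq_zero := by
    ext v
    rw [conn_inner hm hX.smooth hY.smooth, hX.conn_eq_zero, hY.conn_eq_zero]
    simp

end ParallelFields

section SynchronousFrames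

variable [IsManifold I ∞ M] {D : CovariantDerivative I E (fun x : M ↦ TangentSpace I x)}
  {X : Π x : M, TangentSpace I x} {x : M} {ι : Type*}
  [RiemannianBundle (fun x : M ↦ TangentSpace I x)]

/-- A local orthonormal frame near `x` that is parallel at the point `x`. At `x` such a frame
replaces normal coordinates. -/
structure IsSynchronousFrame [Fintype ι]
    (D : CovariantDerivative I E (fun x : M ↦ TangentSpace I x)) (x : M)
    (F : ι → Π x : M, TangentSpace I x) : Prop where
  parallel : ∀ i, ParallelAt D x (F i)
  orthonormal : ∀ᶠ y in 𝓝 x, Orthonormal ℝ (F · y)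
  card : Fintype.card ι = Module.finrank ℝ E

namespace IsSynchronousFrame

variable [Fintype ι] {F : ι → Π x : M, TangentSpace I x}

theorem smooth (hF : IsSynchronousFrame D x F) (i : ι) : SmoothFieldNear x (F i) :=
  (hF.parallel i).smooth

variable [FiniteDimensional ℝ E]

theorem eventually_exists_basis (hF : IsSynchronousFrame D x F) :
    ∀ᶠ y in 𝓝 x, ∃ b : OrthonormalBasis ι ℝ (TangentSpace I y), ∀ i, b i = F i y := by
  filter_upwards [hF.orthonormal] with y hy
  have hspan := hy.linearIndependent.span_eq_top_of_card_eq_finrank' hF.card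
  exact ⟨OrthonormalBasis.mk hy hspan.ge, fun i ↦ by simp⟩

theorem smoothFieldNear_of_inner (hF : IsSynchronousFrame D x F)
    (hX : ∀ i, SmoothFunNear I x (fun y ↦ inner ℝ (F i y) (X y))) : SmoothFieldNear x X := by
  refine SmoothFieldNear.congr (X := ∑ i, (fun y ↦ (inner ℝ (F i y) (X y) : ℝ)) • F i)
    (.sum fun i _ ↦ (hF.smooth i).smul (hX i)) ?_
  filter_upwards [hF.eventually_exists_basis] with y ⟨b, hb⟩
  rw [← b.sum_repr' (X y), Finset.sum_apply]
  simp only [hb]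
  rfl

end IsSynchronousFrame

variable [FiniteDimensional ℝ E]
  [IsContMDiffRiemannianBundle I ∞ E (fun x : M ↦ TangentSpace I x)]

theorem parallelAt_gramSchmidt (hm : D.IsMetricCompatible (V := fun x : M ↦ TangentSpace I x))
    {m : ℕ} {X : Fin m → Π x : M, TangentSpace I x} (hX : ∀ i, ParallelAt D x (X i))
    (ho : Orthonormal ℝ (X · x)) (i : Fin m) :
    ParallelAt D x (fun y ↦ InnerProductSpace.gramSchmidt ℝ (X · y) i) := by
  have gramSchmidt_x : InnerProductSpace.gramSchmidt ℝ (X · x) = (X · x) :=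
    InnerProductSpace.gramSchmidt_of_orthogonal ℝ fun _ _ h ↦ ho.2 h
  induction i using WellFoundedLT.induction with
  | ind i ih =>
    let G (j : Fin m) : Π x : M, TangentSpace I x :=
      fun y ↦ InnerProductSpace.gramSchmidt ℝ (X · y) j
    have recursion : G i = X i - ∑ j ∈ Finset.Iio i, (fun y ↦ (inner ℝ (G j y) (X i y) : ℝ) *
        (inner ℝ (G j y) (G j y) : ℝ)⁻¹) • G j := by
      ext1 y
      simp only [G]
      rw [InnerProductSpace.gramSchmidt_def, Pi.sub_apply, Finset.sum_apply]
      simp [Submodule.starProjection_singleton, div_eq_mul_inv]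
    change ParallelAt D x (G i)
    rw [recursion]
    refine (hX i).sub (.sum fun j hj ↦ ?_)
    have hGj : ParallelAt D x (G j) := ih j (Finset.mem_Iio.1 hj)
    have norm_ne_zero : (inner ℝ (G j x) (G j x) : ℝ) ≠ 0 := by
      simp only [G, gramSchmidt_x, real_inner_self_eq_norm_sq, ho.1 j]
      norm_num
    refine .smul ((hGj.inner hm (hX i)).mul (.comp (φ := fun t ↦ t⁻¹) ?_ (hGj.inner hm hGj))) hGj
    filter_upwards [isOpen_ne.mem_nhds norm_ne_zero] with t ht using contDiffAt_inv ℝ ht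

theorem ParallelAt.normalize (hm : D.IsMetricCompatible (V := fun x : M ↦ TangentSpace I x))
    (hX : ParallelAt D x X) (hXx : X x ≠ 0) : ParallelAt D x (fun y ↦ ‖X y‖⁻¹ • X y) := by
  refine .smul (f := fun y ↦ ‖X y‖⁻¹) ?_ hX
  simp only [norm_eq_sqrt_real_inner]
  refine .comp (φ := fun t ↦ (Real.sqrt t)⁻¹) ?_ (hX.inner hm hX)
  filter_upwards [lt_mem_nhds (real_inner_self_pos.2 hXx)] with t ht
  exact (Real.contDiffAt_sqrt ht.ne').inv (Real.sqrt_pos.2 ht).ne'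

theorem exists_isSynchronousFrame
    (hm : D.IsMetricCompatible (V := fun x : M ↦ TangentSpace I x)) {m : ℕ}
    (b : OrthonormalBasis (Fin m) ℝ (TangentSpace I x)) :
    ∃ F : Fin m → Π x : M, TangentSpace I x, IsSynchronousFrame D x F ∧ ∀ i, F i x = b i := by
  choose X hX hXx using fun i ↦ exists_parallelAt D (b i)
  have ho : Orthonormal ℝ (X · x) := by simpa only [hXx] using b.orthonormal
  let G (i : Fin m) : Π x : M, TangentSpace I x :=
    fun y ↦ InnerProductSpace.gramSchmidt ℝ (X · y) i
  have hG (i) : ParallelAt D x (G i) := parallelAt_gramSchmidt hm hX ho i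
  have hGx (i) : G i x = b i := by
    rw [← hXx]
    exact congrFun (InnerProductSpace.gramSchmidt_of_orthogonal ℝ fun _ _ h ↦ ho.2 h) i
  have hGx_ne (i) : G i x ≠ 0 := hGx i ▸ b.orthonormal.ne_zero i
  have hG_ne : ∀ᶠ y in 𝓝 x, ∀ i, G i y ≠ 0 := Filter.eventually_all.2 fun i ↦
    (((hG i).inner hm (hG i)).smooth.mdiff.continuousAt.eventually_ne
      (inner_self_ne_zero.2 (hGx_ne i))).mono fun y hy h ↦ hy (inner_self_eq_zero.2 h)
  refine ⟨fun i y ↦ ‖G i y‖⁻¹ • G i y, ⟨fun i ↦ (hG i).normalize hm (hGx_ne i), ?_,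
    (Module.finrank_eq_card_basis b.toBasis).symm⟩, fun i ↦ ?_⟩
  · filter_upwards [hG_ne] with y hy
    refine ⟨fun i ↦ norm_smul_inv_norm (𝕜 := ℝ) (hy i), fun i j hij ↦ ?_⟩
    simp only [G, inner_smul_left, inner_smul_right]
    rw [InnerProductSpace.gramSchmidt_orthogonal ℝ _ hij, mul_zero, mul_zero]
  · simp [hGx]

end SynchronousFrames

section ThreeForms

variable [IsManifold I ∞ M] {T : Π x : M, TangentSpace I x [⋀^Fin 3]→L[ℝ] ℝ}
  {X Y Z : Π x : M, TangentSpace I x} {x : M}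

theorem IsSmoothForm.smoothFunNear (hT : IsSmoothForm I T) (hX : SmoothFieldNear x X)
    (hY : SmoothFieldNear x Y) (hZ : SmoothFieldNear x Z) :
    SmoothFunNear I x (fun y ↦ T y ![X y, Y y, Z y]) := by
  filter_upwards [hX, hY, hZ] with y hXy hYy hZy
  convert hT y ![X, Y, Z] (by rw [Fin.forall_fin_succ]; simp [Fin.forall_fin_two, *]) using 3 with z
  ext i
  fin_cases i <;> rfl

end ThreeForms

section SmoothConnections

variable [IsManifold I ∞ M] [FiniteDimensional ℝ E]
  [RiemannianBundle (fun x : M ↦ TangentSpace I x)]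
  [IsContMDiffRiemannianBundle I ∞ E (fun x : M ↦ TangentSpace I x)]
  {X Y Z : Π x : M, TangentSpace I x} {x : M}

theorem smoothFunNear_koszul (hX : SmoothFieldNear x X) (hY : SmoothFieldNear x Y)
    (hZ : SmoothFieldNear x Z) : SmoothFunNear I x (koszul I X Y Z) :=
  ((((((hY.inner hZ).mvfderiv_apply hX).add ((hZ.inner hX).mvfderiv_apply hY)).sub
    ((hX.inner hY).mvfderiv_apply hZ)).add ((hX.mlieBracket hY).inner hZ)).sub
      ((hY.mlieBracket hZ).inner hX)).add ((hZ.mlieBracket hX).inner hY)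

variable (I M) in
theorem smoothConn_leviCivita : SmoothConn (leviCivita I (M := M)) := by
  intro x X Y hX hY
  obtain ⟨F, hF, -⟩ := exists_isSynchronousFrame (leviCivita_isMetricCompatible I) (frame I x)
  refine hF.smoothFieldNear_of_inner fun i ↦
    ((SmoothFunNear.const (1 / 2)).mul (smoothFunNear_koszul hX hY (hF.smooth i))).congr ?_
  filter_upwards [hX.eventually, hY.eventually, (hF.smooth i).eventually] with y hXy hYy hFy
  rw [real_inner_comm]
  exact (inner_leviCivitaFun I hXy.mdiff hYy.mdiff hFy.mdiff).symm

theorem smoothConn_torsionConnection {T : Π x : M, TangentSpace I x [⋀^Fin 3]→L[ℝ] ℝ}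
    (hT : IsSmoothForm I T) : SmoothConn (torsionConnection I T) := by
  intro x X Y hX hY
  obtain ⟨F, hF, -⟩ := exists_isSynchronousFrame (leviCivita_isMetricCompatible I) (frame I x)
  refine hF.smoothFieldNear_of_inner fun i ↦ ?_
  convert ((hF.smooth i).inner (smoothConn_leviCivita I M hX hY)).add
    ((SmoothFunNear.const (1 / 2)).mul (hT.smoothFunNear hX hY (hF.smooth i))) using 2 with y
  rw [torsionConnection_apply, inner_add_right, real_inner_smul_right,
    real_inner_comm (sharp I T y (X y) (Y y)), inner_sharp]

end SmoothConnections

theorem sum_apply_self_eq_sum_apply_self {V ι κ : Type*} [NormedAddCommGroup V]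
    [InnerProductSpace ℝ V] [Fintype ι] [Fintype κ] (B : V →ₗ[ℝ] V →ₗ[ℝ] ℝ)
    (b : OrthonormalBasis ι ℝ V) (c : OrthonormalBasis κ ℝ V) :
    ∑ i, B (b i) (b i) = ∑ j, B (c j) (c j) := by
  calc ∑ i, B (b i) (b i) = ∑ i, ∑ j, inner ℝ (c j) (b i) * B (c j) (b i) := by
        refine Finset.sum_congr rfl fun i _ ↦ ?_
        nth_rw 1 [← c.sum_repr' (b i)]
        simp
    _ = ∑ j, ∑ i, inner ℝ (b i) (c j) * B (c j) (b i) := by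
        rw [Finset.sum_comm]
        simp only [real_inner_comm]
    _ = ∑ j, B (c j) (c j) := by
        refine Finset.sum_congr rfl fun j _ ↦ ?_
        conv_rhs => arg 2; rw [← b.sum_repr' (c j)]
        simp

section MetricCurvature

variable [IsManifold I ∞ M] [FiniteDimensional ℝ E]
  [RiemannianBundle (fun x : M ↦ TangentSpace I x)]
  {D : CovariantDerivative I E (fun x : M ↦ TangentSpace I x)}
  {X Y Z W : Π x : M, TangentSpace I x} {x : M} {ι : Type*} [Fintype ι]

theorem ricci_eq_sum (hD : SmoothConn D) (b : OrthonormalBasis ι ℝ (TangentSpace I x))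
    (u v : TangentSpace I x) :
    ricci I D x u v = ∑ i, inner ℝ (curvature I D x (b i) u v) (b i) :=
  sum_apply_self_eq_sum_apply_self
    ((innerₗ (TangentSpace I x)).comp ((isLinearMap_curvature_left hD u v).mk' _)) (frame I x) b

theorem ricci_add_left (hD : SmoothConn D) (u u' v : TangentSpace I x) :
    ricci I D x (u + u') v = ricci I D x u v + ricci I D x u' v := by
  simp only [ricci, (isLinearMap_curvature_middle hD _ _).map_add, inner_add_left,
    Finset.sum_add_distrib]

theorem ricci_smul_left (hD : SmoothConn D) (c : ℝ) (u v : TangentSpace I x) :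
    ricci I D x (c • u) v = c * ricci I D x u v := by
  simp only [ricci, (isLinearMap_curvature_middle hD _ _).map_smul, real_inner_smul_left,
    Finset.mul_sum]

theorem ricci_add_right (hD : SmoothConn D) (u v v' : TangentSpace I x) :
    ricci I D x u (v + v') = ricci I D x u v + ricci I D x u v' := by
  simp only [ricci, (isLinearMap_curvature_right hD _ _).map_add, inner_add_left,
    Finset.sum_add_distrib]

theorem ricci_smul_right (hD : SmoothConn D) (c : ℝ) (u v : TangentSpace I x) :
    ricci I D x u (c • v) = c * ricci I D x u v := by
  simp only [ricci, (isLinearMap_curvature_right hD _ _).map_smul, real_inner_smul_left,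
    Finset.mul_sum]

theorem scalarCurvature_eq_sum (hD : SmoothConn D) (b : OrthonormalBasis ι ℝ (TangentSpace I x)) :
    scalarCurvature I D x = ∑ i, ricci I D x (b i) (b i) :=
  sum_apply_self_eq_sum_apply_self (LinearMap.mk₂ ℝ (ricci I D x) (ricci_add_left hD)
    (ricci_smul_left hD) (ricci_add_right hD) (ricci_smul_right hD)) (frame I x) b

variable [IsContMDiffRiemannianBundle I ∞ E (fun x : M ↦ TangentSpace I x)]

theorem mvfderiv_mvfderiv_inner (hD : SmoothConn D)
    (hm : D.IsMetricCompatible (V := fun x : M ↦ TangentSpace I x)) (hX : SmoothFieldNear x X)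
    (hZ : SmoothFieldNear x Z) (hW : SmoothFieldNear x W) (u : TangentSpace I x) :
    d% (fun y ↦ d% (fun z ↦ inner ℝ (Z z) (W z)) y (X y)) x u =
      inner ℝ (D (fun y ↦ D Z y (X y)) x u) (W x) + inner ℝ (D Z x (X x)) (D W x u) +
        (inner ℝ (D Z x u) (D W x (X x)) + inner ℝ (Z x) (D (fun y ↦ D W y (X y)) x u)) := by
  have hXZ := hD hX hZ
  have hXW := hD hX hW
  rw [← conn_inner hm hXZ hW, ← conn_inner hm hZ hXW, ← _root_.add_apply,
    ← mvfderiv_fun_add (hXZ.inner hW).mdiff (hZ.inner hXW).mdiff]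
  refine congrArg (fun L ↦ L u) (mvfderiv_congr ?_)
  filter_upwards [hZ.eventually, hW.eventually] with y hZy hWy using conn_inner hm hZy hWy _

theorem inner_curvatureOnFields_skew (hD : SmoothConn D)
    (hm : D.IsMetricCompatible (V := fun x : M ↦ TangentSpace I x)) (hX : SmoothFieldNear x X)
    (hY : SmoothFieldNear x Y) (hZ : SmoothFieldNear x Z) (hW : SmoothFieldNear x W) :
    inner ℝ (curvatureOnFields I D X Y Z x) (W x) =
      -inner ℝ (curvatureOnFields I D X Y W x) (Z x) := by
  have h := (hZ.inner hW).mvfderiv_mlieBracket hX hY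
  rw [conn_inner hm hZ hW, mvfderiv_mvfderiv_inner hD hm hY hZ hW,
    mvfderiv_mvfderiv_inner hD hm hX hZ hW] at h
  rw [real_inner_comm (Z x)]
  simp only [curvatureOnFields, inner_sub_left, inner_sub_right]
  linarith

theorem inner_curvature_skew (hD : SmoothConn D)
    (hm : D.IsMetricCompatible (V := fun x : M ↦ TangentSpace I x)) (u v w z : TangentSpace I x) :
    inner ℝ (curvature I D x u v w) z = -inner ℝ (curvature I D x u v z) w := by
  have h := inner_curvatureOnFields_skew hD hm (smoothFieldNear_extend u)
    (smoothFieldNear_extend v) (smoothFieldNear_extend w) (smoothFieldNear_extend z)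
  simp only [extend_apply_self] at h
  exact h

theorem ricci_comm (hD : SmoothConn D)
    (hm : D.IsMetricCompatible (V := fun x : M ↦ TangentSpace I x)) (hD₀ : D.torsion = 0)
    (u v : TangentSpace I x) : ricci I D x u v = ricci I D x v u := by
  refine Finset.sum_congr rfl fun i _ ↦ ?_
  set e := frame I x i
  have bianchi := congrArg (inner ℝ · e) (curvature_bianchi hD hD₀ e u v)
  have skew := inner_curvature_skew hD hm u v e e
  simp only [inner_add_left, inner_zero_left, curvature_swap v e u, inner_neg_left] at bianchi
  linarith

end MetricCurvature

section ContractedBianchi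

variable [IsManifold I ∞ M] [RiemannianBundle (fun x : M ↦ TangentSpace I x)]
  {D : CovariantDerivative I E (fun x : M ↦ TangentSpace I x)}
  {X Y Z W : Π x : M, TangentSpace I x} {x : M}

theorem mvfderiv_inner_curvatureOnFields_swap (X Y Z W : Π x : M, TangentSpace I x) (x : M) :
    d% (fun y ↦ inner ℝ (curvatureOnFields I D X Y Z y) (W y)) x =
      -d% (fun y ↦ inner ℝ (curvatureOnFields I D Y X Z y) (W y)) x := by
  simp only [curvatureOnFields_swap X Y, inner_neg_left]
  exact mvfderiv_fun_neg

variable [FiniteDimensional ℝ E] {ι : Type*} [Fintype ι] {F : ι → Π x : M, TangentSpace I x}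

theorem IsSynchronousFrame.ricci_eventuallyEq (hF : IsSynchronousFrame D x F) (hD : SmoothConn D)
    (j k : ι) : (fun y ↦ ricci I D y (F j y) (F k y)) =ᶠ[𝓝 x]
      fun y ↦ ∑ i, inner ℝ (curvatureOnFields I D (F i) (F j) (F k) y) (F i y) := by
  filter_upwards [hF.eventually_exists_basis,
    Filter.eventually_all.2 fun i ↦ (hF.smooth i).eventually] with y ⟨b, hb⟩ hs
  simp only [ricci_eq_sum hD b, hb, curvature_apply_fields hD (hs _) (hs _) (hs _)]

theorem IsSynchronousFrame.scalarCurvature_eventuallyEq (hF : IsSynchronousFrame D x F)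
    (hD : SmoothConn D) :
    scalarCurvature I D =ᶠ[𝓝 x] fun y ↦ ∑ j, ricci I D y (F j y) (F j y) := by
  filter_upwards [hF.eventually_exists_basis] with y ⟨b, hb⟩
  simp only [scalarCurvature_eq_sum hD b, hb]

variable [IsContMDiffRiemannianBundle I ∞ E (fun x : M ↦ TangentSpace I x)]

theorem IsSynchronousFrame.smooth_ricci (hF : IsSynchronousFrame D x F) (hD : SmoothConn D)
    (j k : ι) : SmoothFunNear I x (fun y ↦ ricci I D y (F j y) (F k y)) :=
  .congr (.sum fun i _ ↦ (hD.smooth_curvatureOnFields (hF.smooth i) (hF.smooth j)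
    (hF.smooth k)).inner (hF.smooth i)) (hF.ricci_eventuallyEq hD j k).symm

theorem second_bianchi_inner (hD : SmoothConn D)
    (hm : D.IsMetricCompatible (V := fun x : M ↦ TangentSpace I x)) (hD₀ : D.torsion = 0)
    (hX : ParallelAt D x X) (hY : ParallelAt D x Y) (hZ : ParallelAt D x Z)
    (hW : ParallelAt D x W) (hV : ParallelAt D x V) :
    d% (fun y ↦ inner ℝ (curvatureOnFields I D X Y W y) (V y)) x (Z x) +
      d% (fun y ↦ inner ℝ (curvatureOnFields I D Y Z W y) (V y)) x (X x) +
      d% (fun y ↦ inner ℝ (curvatureOnFields I D Z X W y) (V y)) x (Y x) = 0 := by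
  have bianchi := congrArg (inner ℝ · (V x)) (second_bianchi hD hD₀ hX hY hZ hW)
  simpa [conn_inner hm (hD.smooth_curvatureOnFields _ _ _) hV.smooth, hV.conn_eq_zero,
    hX.smooth, hY.smooth, hZ.smooth, hW.smooth, inner_add_left] using bianchi

theorem mvfderiv_inner_curvatureOnFields_skew (hD : SmoothConn D)
    (hm : D.IsMetricCompatible (V := fun x : M ↦ TangentSpace I x)) (hX : SmoothFieldNear x X)
    (hY : SmoothFieldNear x Y) (hZ : SmoothFieldNear x Z) (hW : SmoothFieldNear x W) :
    d% (fun y ↦ inner ℝ (curvatureOnFields I D X Y Z y) (W y)) x =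
      -d% (fun y ↦ inner ℝ (curvatureOnFields I D X Y W y) (Z y)) x := by
  rw [← mvfderiv_fun_neg]
  refine mvfderiv_congr ?_
  filter_upwards [hX.eventually, hY.eventually, hZ.eventually, hW.eventually] with y hX hY hZ hW
  exact inner_curvatureOnFields_skew hD hm hX hY hZ hW

theorem contracted_bianchi (hD : SmoothConn D)
    (hm : D.IsMetricCompatible (V := fun x : M ↦ TangentSpace I x)) (hD₀ : D.torsion = 0)
    (hF : IsSynchronousFrame D x F) (m : ι) :
    d% (scalarCurvature I D) x (F m x) =
      2 * ∑ i, d% (fun y ↦ ricci I D y (F m y) (F i y)) x (F i x) := by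
  let K (i j k l : ι) (y : M) : ℝ := inner ℝ (curvatureOnFields I D (F i) (F j) (F k) y) (F l y)
  have hs := hF.smooth
  have mdiff_K (i j k l) : MDiffAt (K i j k l) x :=
    ((hD.smooth_curvatureOnFields (hs i) (hs j) (hs k)).inner (hs l)).mdiff
  have d_ricci (j k) (u : TangentSpace I x) :
      d% (fun y ↦ ricci I D y (F j y) (F k y)) x u = ∑ i, d% (K i j k i) x u := by
    rw [mvfderiv_congr (hF.ricci_eventuallyEq hD j k),
      mvfderiv_finsetSum fun i _ ↦ mdiff_K i j k i, _root_.sum_apply]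
  have bianchi (i j) : d% (K i j j i) x (F m x) =
      d% (K i m j i) x (F j x) + d% (K j m i j) x (F i x) := by
    have h := second_bianchi_inner hD hm hD₀ (hF.parallel i) (hF.parallel j) (hF.parallel m)
      (hF.parallel j) (hF.parallel i)
    rw [mvfderiv_inner_curvatureOnFields_skew hD hm (hs j) (hs m) (hs j) (hs i),
      mvfderiv_inner_curvatureOnFields_swap (F m)] at h
    simp only [_root_.neg_apply] at h
    linarith
  calc d% (scalarCurvature I D) x (F m x)
      = ∑ j, ∑ i, d% (K i j j i) x (F m x) := by
        rw [mvfderiv_congr (hF.scalarCurvature_eventuallyEq hD),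
          mvfderiv_finsetSum fun j _ ↦ (hF.smooth_ricci hD j j).mdiff, _root_.sum_apply]
        simp only [d_ricci]
    _ = ∑ j, ∑ i, d% (K i m j i) x (F j x) + ∑ i, ∑ j, d% (K j m i j) x (F i x) := by
        simp only [bianchi, Finset.sum_add_distrib]
        exact congrArg (_ + ·) Finset.sum_comm
    _ = 2 * ∑ i, d% (fun y ↦ ricci I D y (F m y) (F i y)) x (F i x) := by
        simp only [d_ricci, two_mul]

end ContractedBianchi

section AlternatingForms

variable {R V W : Type*} [Ring R] [AddCommGroup V] [Module R V] [TopologicalSpace V]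
  [AddCommGroup W] [Module R W] [TopologicalSpace W] (φ : V [⋀^Fin 3]→L[R] W)

theorem alternating_swap_left (u v w : V) : φ ![v, u, w] = -φ ![u, v, w] := by
  rw [← φ.coe_toAlternatingMap, ← φ.toAlternatingMap.map_swap (i := 0) (j := 1) _ (by decide)]
  refine congrArg φ ?_
  ext i
  fin_cases i <;> rfl

theorem alternating_rotate (u v w : V) : φ ![v, w, u] = φ ![u, v, w] := by
  convert φ.toAlternatingMap.map_perm ![u, v, w] (finRotate 3) using 1
  · refine congrArg φ ?_
    ext i
    fin_cases i <;> rfl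
  · simp

theorem alternating_swap_right (u v w : V) : φ ![u, w, v] = -φ ![u, v, w] := by
  rw [← alternating_rotate φ u w v, alternating_swap_left φ v, alternating_rotate φ u v]

end AlternatingForms

section CovariantDerivativesOfForms

variable [IsManifold I ∞ M] {D : CovariantDerivative I E (fun x : M ↦ TangentSpace I x)}
  {T : Π x : M, TangentSpace I x [⋀^Fin 3]→L[ℝ] ℝ} {X Y Z : Π x : M, TangentSpace I x} {x : M}

/-- The covariant derivative `(D_u T)(X, Y, Z)` of a 3-form, on vector fields. -/
def covDerivOnFields (D : CovariantDerivative I E (fun x : M ↦ TangentSpace I x))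
    (T : Π x : M, TangentSpace I x [⋀^Fin 3]→L[ℝ] ℝ) (X Y Z : Π x : M, TangentSpace I x)
    (x : M) (u : TangentSpace I x) : ℝ :=
  d% (fun y ↦ T y ![X y, Y y, Z y]) x u - T x ![D X x u, Y x, Z x] - T x ![X x, D Y x u, Z x]
    - T x ![X x, Y x, D Z x u]

theorem covDerivOnFields_rotate (X Y Z : Π x : M, TangentSpace I x) (u : TangentSpace I x) :
    covDerivOnFields D T Y Z X x u = covDerivOnFields D T X Y Z x u := by
  simp only [covDerivOnFields, alternating_rotate (T _) (X _), alternating_rotate (T x) (D X x u)]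
  ring

theorem covDerivForm_eq_covDerivOnFields (u a b c : TangentSpace I x) :
    covDerivForm I D T x u ![a, b, c] =
      covDerivOnFields D T (extend E a) (extend E b) (extend E c) x u := by
  have vecCons_apply (y) : (fun i ↦ extend E ((![a, b, c] : Fin 3 → TangentSpace I x) i) y) =
      ![extend E a y, extend E b y, extend E c y] := by
    ext i; fin_cases i <;> rfl
  have update₀ (v) : Function.update ![a, b, c] 0 v = ![v, b, c] := by ext i; fin_cases i <;> rfl
  have update₁ (v) : Function.update ![a, b, c] 1 v = ![a, v, c] := by ext i; fin_cases i <;> rfl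
  have update₂ (v) : Function.update ![a, b, c] 2 v = ![a, b, v] := by ext i; fin_cases i <;> rfl
  simp only [covDerivForm, covDerivOnFields, vecCons_apply, Fin.sum_univ_three, update₀, update₁,
    update₂, extend_apply_self, Matrix.cons_val]
  ring

theorem smoothTensorialAt_covDerivOnFields (hT : IsSmoothForm I T) (hY : SmoothFieldNear x Y)
    (hZ : SmoothFieldNear x Z) (u : TangentSpace I x) :
    SmoothTensorialAt x fun X ↦ covDerivOnFields D T X Y Z x u where
  add {X X'} hX hX' := by
    simp only [covDerivOnFields, Pi.add_apply, conn_add hX hX', _root_.add_apply,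
      ContinuousAlternatingMap.vecCons_add]
    rw [mvfderiv_fun_add (hT.smoothFunNear hX hY hZ).mdiff (hT.smoothFunNear hX' hY hZ).mdiff,
      _root_.add_apply]
    ring
  smul {f X} hf hX := by
    simp only [covDerivOnFields, Pi.smul_apply', conn_smul hf hX,
      ContinuousAlternatingMap.vecCons_add, ContinuousAlternatingMap.vecCons_smul, smul_eq_mul]
    rw [mvfderiv_fun_mul hf.mdiff (hT.smoothFunNear hX hY hZ).mdiff]
    simp only [_root_.add_apply, _root_.smul_apply, smul_eq_mul]
    ring

variable [FiniteDimensional ℝ E]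

theorem covDerivForm_apply_fields (hT : IsSmoothForm I T) (hX : SmoothFieldNear x X)
    (hY : SmoothFieldNear x Y) (hZ : SmoothFieldNear x Z) (u : TangentSpace I x) :
    covDerivForm I D T x u ![X x, Y x, Z x] = covDerivOnFields D T X Y Z x u := by
  have hX' := smoothFieldNear_extend (X x)
  have hY' := smoothFieldNear_extend (Y x)
  have hZ' := smoothFieldNear_extend (Z x)
  rw [covDerivForm_eq_covDerivOnFields,
    (smoothTensorialAt_covDerivOnFields hT hY' hZ' u).pointwise hX' hX (by simp),
    ← covDerivOnFields_rotate,
    (smoothTensorialAt_covDerivOnFields hT hZ' hX u).pointwise hY' hY (by simp),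
    ← covDerivOnFields_rotate,
    (smoothTensorialAt_covDerivOnFields hT hX hY u).pointwise hZ' hZ (by simp),
    ← covDerivOnFields_rotate]

theorem ParallelAt.covDerivForm_eq (hX : ParallelAt D x X) (hY : ParallelAt D x Y)
    (hZ : ParallelAt D x Z) (hT : IsSmoothForm I T) (u : TangentSpace I x) :
    covDerivForm I D T x u ![X x, Y x, Z x] = d% (fun y ↦ T y ![X y, Y y, Z y]) x u := by
  rw [covDerivForm_apply_fields hT hX.smooth hY.smooth hZ.smooth, covDerivOnFields,
    hX.conn_eq_zero, hY.conn_eq_zero, hZ.conn_eq_zero]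
  simp only [_root_.zero_apply]
  rw [(T x).map_coord_zero (m := ![0, Y x, Z x]) 0 rfl,
    (T x).map_coord_zero (m := ![X x, 0, Z x]) 1 rfl,
    (T x).map_coord_zero (m := ![X x, Y x, 0]) 2 rfl]
  ring

theorem extDeriv_eq_covDerivForm (hD₀ : D.torsion = 0) (a b c d : TangentSpace I x) :
    extDeriv I T x a b c d =
      covDerivForm I D T x a ![b, c, d] - covDerivForm I D T x b ![a, c, d] +
        covDerivForm I D T x c ![a, b, d] - covDerivForm I D T x d ![a, b, c] := by
  have bracket (v w : TangentSpace I x) : mlieBracket I (extend E v) (extend E w) x =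
      D (extend E w) x v - D (extend E v) x w := by
    rw [← conn_sub_conn_of_torsion_eq_zero hD₀ (smoothFieldNear_extend v)
      (smoothFieldNear_extend w)]
    simp
  simp only [covDerivForm_eq_covDerivOnFields, covDerivOnFields, extDeriv, extDerivOnFields,
    bracket, extend_apply_self, ContinuousAlternatingMap.map_vecCons_sub,
    alternating_swap_left (T x) (D _ x _), alternating_rotate (T x) (D _ x _)]
  ring

end CovariantDerivativesOfForms

section TorsionCurvature

variable [FiniteDimensional ℝ E] [RiemannianBundle (fun x : M ↦ TangentSpace I x)]
  {T : Π x : M, TangentSpace I x [⋀^Fin 3]→L[ℝ] ℝ} {X Y Z : Π x : M, TangentSpace I x} {x : M}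
  {ι : Type*} [Fintype ι]

/-- The symmetric 2-tensor `Q_jk = T_jab T_kab` of a 3-form. -/
def torsionSq (T : Π x : M, TangentSpace I x [⋀^Fin 3]→L[ℝ] ℝ) (x : M) (u v : TangentSpace I x) :
    ℝ :=
  ∑ i, inner ℝ (sharp I T x u (frame I x i)) (sharp I T x v (frame I x i))

/-- The squared norm `T_abc T_abc` of a 3-form. -/
def torsionNormSq (T : Π x : M, TangentSpace I x [⋀^Fin 3]→L[ℝ] ℝ) (x : M) : ℝ :=
  ∑ i, torsionSq T x (frame I x i) (frame I x i)

theorem torsionSq_comm (u v : TangentSpace I x) : torsionSq T x u v = torsionSq T x v u := by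
  simp only [torsionSq, real_inner_comm]

variable [IsManifold I ∞ M] [IsContMDiffRiemannianBundle I ∞ E (fun x : M ↦ TangentSpace I x)]

theorem isLinearMap_sharp_left (T : Π x : M, TangentSpace I x [⋀^Fin 3]→L[ℝ] ℝ) (x : M)
    (v : TangentSpace I x) : IsLinearMap ℝ fun u ↦ sharp I T x u v :=
  ⟨fun u u' ↦ sharp_add_left I T x u u' v, fun c u ↦ sharp_smul_left I T x c u v⟩

theorem isLinearMap_sharp_right (T : Π x : M, TangentSpace I x [⋀^Fin 3]→L[ℝ] ℝ) (x : M)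
    (u : TangentSpace I x) : IsLinearMap ℝ fun v ↦ sharp I T x u v := by
  simp_rw [sharp_swap I T x u]
  exact (-(isLinearMap_sharp_left T x u).mk' _).isLinear

theorem torsionSq_eq_sum_inner (b : OrthonormalBasis ι ℝ (TangentSpace I x))
    (u v : TangentSpace I x) :
    torsionSq T x u v = ∑ i, inner ℝ (sharp I T x u (b i)) (sharp I T x v (b i)) :=
  sum_apply_self_eq_sum_apply_self ((innerₗ (TangentSpace I x)).compl₁₂
    ((isLinearMap_sharp_right T x u).mk' _) ((isLinearMap_sharp_right T x v).mk' _)) (frame I x) b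

theorem torsionSq_eq_sum (b : OrthonormalBasis ι ℝ (TangentSpace I x)) (u v : TangentSpace I x) :
    torsionSq T x u v = ∑ i, ∑ j, T x ![u, b i, b j] * T x ![v, b i, b j] := by
  rw [torsionSq_eq_sum_inner b]
  refine Finset.sum_congr rfl fun i _ ↦ ?_
  rw [← b.sum_inner_mul_inner]
  simp only [real_inner_comm (sharp I T x v (b i)), inner_sharp]

theorem torsionNormSq_eq_sum_torsionSq (b : OrthonormalBasis ι ℝ (TangentSpace I x)) :
    torsionNormSq T x = ∑ i, torsionSq T x (b i) (b i) := by
  simp only [torsionNormSq, torsionSq]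
  rw [Finset.sum_comm, Finset.sum_comm (s := (Finset.univ : Finset ι))]
  refine Finset.sum_congr rfl fun j _ ↦ ?_
  let L := (isLinearMap_sharp_left T x (frame I x j)).mk' _
  exact sum_apply_self_eq_sum_apply_self ((innerₗ (TangentSpace I x)).compl₁₂ L L) (frame I x) b

theorem IsSmoothForm.smooth_sharp (hT : IsSmoothForm I T) (hX : SmoothFieldNear x X)
    (hY : SmoothFieldNear x Y) : SmoothFieldNear x fun y ↦ sharp I T y (X y) (Y y) := by
  have h := ((smoothConn_torsionConnection hT hX hY).sub (smoothConn_leviCivita I M hX hY)).smul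
    (.const 2)
  refine h.congr (.of_forall fun y ↦ ?_)
  change (2 : ℝ) • (torsionConnection I T Y y (X y) - leviCivita I Y y (X y)) = _
  rw [torsionConnection_apply]
  module

theorem conn_torsionConnection_torsionConnection (hT : IsSmoothForm I T)
    (hX : SmoothFieldNear x X) (hY : ParallelAt (leviCivita I) x Y) (u : TangentSpace I x) :
    torsionConnection I T (fun y ↦ torsionConnection I T Y y (X y)) x u =
      leviCivita I (fun y ↦ leviCivita I Y y (X y)) x u +
        (1 / 2 : ℝ) • leviCivita I (fun y ↦ sharp I T y (X y) (Y y)) x u +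
        (1 / 4 : ℝ) • sharp I T x u (sharp I T x (X x) (Y x)) := by
  have smooth_sharp := hT.smooth_sharp hX hY.smooth
  have half : SmoothFunNear I x fun _ : M ↦ (1 / 2 : ℝ) := .const _
  have decomposition : (fun y ↦ torsionConnection I T Y y (X y)) =
      (fun y ↦ leviCivita I Y y (X y)) +
        (fun _ : M ↦ (1 / 2 : ℝ)) • fun y ↦ sharp I T y (X y) (Y y) := rfl
  have conn_x : torsionConnection I T Y x (X x) = (1 / 2 : ℝ) • sharp I T x (X x) (Y x) := by
    rw [torsionConnection_apply, hY.conn_eq_zero, _root_.zero_apply, zero_add]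
  rw [torsionConnection_apply, conn_x, (isLinearMap_sharp_right T x u).map_smul, decomposition,
    conn_add (smoothConn_leviCivita I M hX hY.smooth) (smooth_sharp.smul half), _root_.add_apply,
    conn_smul half smooth_sharp, mvfderiv_const, _root_.zero_apply]
  module

theorem curvatureOnFields_torsionConnection (hT : IsSmoothForm I T)
    (hX : ParallelAt (leviCivita I) x X) (hY : ParallelAt (leviCivita I) x Y)
    (hZ : ParallelAt (leviCivita I) x Z) :
    curvatureOnFields I (torsionConnection I T) X Y Z x =
      curvatureOnFields I (leviCivita I) X Y Z x +
        (1 / 2 : ℝ) • (leviCivita I (fun y ↦ sharp I T y (Y y) (Z y)) x (X x) -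
          leviCivita I (fun y ↦ sharp I T y (X y) (Z y)) x (Y x)) +
        (1 / 4 : ℝ) • (sharp I T x (X x) (sharp I T x (Y x) (Z x)) -
          sharp I T x (Y x) (sharp I T x (X x) (Z x))) := by
  simp only [curvatureOnFields]
  rw [conn_torsionConnection_torsionConnection hT hY.smooth hZ,
    conn_torsionConnection_torsionConnection hT hX.smooth hZ,
    hX.mlieBracket_eq_zero (leviCivita_torsion I) hY, map_zero, map_zero]
  module

theorem inner_leviCivita_sharp (hT : IsSmoothForm I T) (hX : SmoothFieldNear x X)
    (hY : SmoothFieldNear x Y) (hZ : ParallelAt (leviCivita I) x Z) (u : TangentSpace I x) :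
    inner ℝ (leviCivita I (fun y ↦ sharp I T y (X y) (Y y)) x u) (Z x) =
      d% (fun y ↦ T y ![X y, Y y, Z y]) x u := by
  simp only [← inner_sharp]
  rw [conn_inner (leviCivita_isMetricCompatible I) (hT.smooth_sharp hX hY) hZ.smooth,
    hZ.conn_eq_zero, _root_.zero_apply, inner_zero_right, add_zero]

theorem inner_curvatureOnFields_torsionConnection (hT : IsSmoothForm I T)
    (hX : ParallelAt (leviCivita I) x X) (hY : ParallelAt (leviCivita I) x Y)
    (hZ : ParallelAt (leviCivita I) x Z) :
    inner ℝ (curvatureOnFields I (torsionConnection I T) X Y Z x) (X x) =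
      inner ℝ (curvatureOnFields I (leviCivita I) X Y Z x) (X x) +
        1 / 2 * d% (fun y ↦ T y ![X y, Y y, Z y]) x (X x) -
        1 / 4 * inner ℝ (sharp I T x (Y x) (X x)) (sharp I T x (Z x) (X x)) := by
  have vanish (y : M) (w : TangentSpace I y) : T y ![X y, w, X y] = 0 :=
    (T y).map_eq_zero_of_eq _ (i := 0) (j := 2) rfl (by decide)
  have rotate (y) : T y ![Y y, Z y, X y] = T y ![X y, Y y, Z y] := alternating_rotate (T y) _ _ _
  have quadratic : inner ℝ (sharp I T x (Y x) (sharp I T x (X x) (Z x))) (X x) =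
      inner ℝ (sharp I T x (Y x) (X x)) (sharp I T x (Z x) (X x)) := by
    rw [inner_sharp, alternating_swap_right, ← inner_sharp, ← inner_neg_right, ← sharp_swap]
  rw [curvatureOnFields_torsionConnection hT hX hY hZ]
  simp only [inner_add_left, inner_sub_left, real_inner_smul_left,
    inner_leviCivita_sharp hT hY.smooth hZ.smooth hX,
    inner_leviCivita_sharp hT hX.smooth hZ.smooth hX, quadratic, vanish, rotate,
    inner_sharp T x (X x), mvfderiv_const, _root_.zero_apply]
  ring

theorem codiff_swap (hT : IsSmoothForm I T) (u v : TangentSpace I x) :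
    codiff I T x u v = -codiff I T x v u := by
  obtain ⟨Y, hY, rfl⟩ := exists_parallelAt (leviCivita I) u
  obtain ⟨Z, hZ, rfl⟩ := exists_parallelAt (leviCivita I) v
  rw [codiff, codiff, neg_inj, ← Finset.sum_neg_distrib]
  refine Finset.sum_congr rfl fun i _ ↦ ?_
  obtain ⟨X, hX, hXx⟩ := exists_parallelAt (leviCivita I) (frame I x i)
  simp only [← hXx, hX.covDerivForm_eq hY hZ hT, hX.covDerivForm_eq hZ hY hT,
    alternating_swap_right _ (X _) (Z _) (Y _), mvfderiv_fun_neg, _root_.neg_apply]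

theorem ricci_torsionConnection (hT : IsSmoothForm I T) (u v : TangentSpace I x) :
    ricci I (torsionConnection I T) x u v =
      ricci I (leviCivita I) x u v - 1 / 2 * codiff I T x u v - 1 / 4 * torsionSq T x u v := by
  have hD := smoothConn_torsionConnection hT
  have hD₀ := smoothConn_leviCivita I M
  obtain ⟨Y, hY, rfl⟩ := exists_parallelAt (leviCivita I) u
  obtain ⟨Z, hZ, rfl⟩ := exists_parallelAt (leviCivita I) v
  rw [ricci, ricci, codiff, torsionSq, mul_neg, sub_neg_eq_add, Finset.mul_sum, Finset.mul_sum,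
    ← Finset.sum_add_distrib, ← Finset.sum_sub_distrib]
  refine Finset.sum_congr rfl fun i _ ↦ ?_
  obtain ⟨X, hX, hXx⟩ := exists_parallelAt (leviCivita I) (frame I x i)
  rw [← hXx, curvature_apply_fields hD hX.smooth hY.smooth hZ.smooth,
    curvature_apply_fields hD₀ hX.smooth hY.smooth hZ.smooth, hX.covDerivForm_eq hY hZ hT,
    inner_curvatureOnFields_torsionConnection hT hX hY hZ]

theorem ricci_leviCivita_eq (hT : IsSmoothForm I T) (u v : TangentSpace I x) :
    ricci I (leviCivita I) x u v =
      (ricci I (torsionConnection I T) x u v + ricci I (torsionConnection I T) x v u) / 2 +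
        1 / 4 * torsionSq T x u v := by
  rw [ricci_torsionConnection hT, ricci_torsionConnection hT v u, codiff_swap hT v u,
    torsionSq_comm v u, ricci_comm (smoothConn_leviCivita I M) (leviCivita_isMetricCompatible I)
      (leviCivita_torsion I) v u]
  ring

theorem scalarCurvature_leviCivita_eq (hT : IsSmoothForm I T) (x : M) :
    scalarCurvature I (leviCivita I) x =
      scalarCurvature I (torsionConnection I T) x + 1 / 4 * torsionNormSq T x := by
  simp only [scalarCurvature, torsionNormSq, ricci_leviCivita_eq hT, add_self_div_two,
    Finset.sum_add_distrib, Finset.mul_sum]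

end TorsionCurvature

section TorsionOneForms

variable [IsManifold I ∞ M] [FiniteDimensional ℝ E]
  [RiemannianBundle (fun x : M ↦ TangentSpace I x)]
  [IsContMDiffRiemannianBundle I ∞ E (fun x : M ↦ TangentSpace I x)]
  {T : Π x : M, TangentSpace I x [⋀^Fin 3]→L[ℝ] ℝ} {x : M}

theorem theta_eq_sum (T : Π x : M, TangentSpace I x [⋀^Fin 3]→L[ℝ] ℝ) (u : TangentSpace I x) :
    theta I T x u = -∑ s, ∑ a, ∑ b, T x ![u, frame I x a, frame I x b] *
      covDerivForm I (leviCivita I) T x (frame I x s) ![frame I x s, frame I x a, frame I x b] := by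
  rw [← Finset.sum_comm_cycle, theta, ← Finset.sum_neg_distrib]
  refine Finset.sum_congr rfl fun a _ ↦ ?_
  rw [← Finset.sum_neg_distrib]
  refine Finset.sum_congr rfl fun b _ ↦ ?_
  rw [← Finset.mul_sum, codiff, neg_mul, mul_comm]

theorem bigTheta_eq_sum (T : Π x : M, TangentSpace I x [⋀^Fin 3]→L[ℝ] ℝ) (u : TangentSpace I x) :
    bigTheta I T x u =
      ∑ a, ∑ b, ∑ c, T x ![frame I x a, frame I x b, frame I x c] *
          covDerivForm I (leviCivita I) T x u ![frame I x a, frame I x b, frame I x c] -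
        3 * ∑ a, ∑ b, ∑ c, T x ![frame I x a, frame I x b, frame I x c] *
          covDerivForm I (leviCivita I) T x (frame I x a) ![u, frame I x b, frame I x c] := by
  let t a b c := T x ![frame I x a, frame I x b, frame I x c]
  let P a b c := covDerivForm I (leviCivita I) T x (frame I x a) ![u, frame I x b, frame I x c]
  have second : ∑ a, ∑ b, ∑ c, t a b c * P b a c = -∑ a, ∑ b, ∑ c, t a b c * P a b c := by
    rw [Finset.sum_comm]
    simp only [← Finset.sum_neg_distrib, ← neg_mul, t, ← alternating_swap_left]
  have third : ∑ a, ∑ b, ∑ c, t a b c * P c a b = ∑ a, ∑ b, ∑ c, t a b c * P a b c := by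
    rw [Finset.sum_comm_cycle]
    simp only [t, alternating_rotate]
  simp only [bigTheta, extDeriv_eq_covDerivForm (leviCivita_torsion I), mul_add, mul_sub,
    Finset.sum_add_distrib, Finset.sum_sub_distrib]
  linarith

variable {ι : Type*} [Fintype ι] {F : ι → Π x : M, TangentSpace I x}
  {D : CovariantDerivative I E (fun x : M ↦ TangentSpace I x)}

theorem IsSynchronousFrame.torsionSq_eventuallyEq (hF : IsSynchronousFrame D x F) (j k : ι) :
    (fun y ↦ torsionSq T y (F j y) (F k y)) =ᶠ[𝓝 x]
      fun y ↦ ∑ a, ∑ b, T y ![F j y, F a y, F b y] * T y ![F k y, F a y, F b y] := by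
  filter_upwards [hF.eventually_exists_basis] with y ⟨b, hb⟩
  simp only [torsionSq_eq_sum b, hb]

theorem IsSynchronousFrame.torsionNormSq_eventuallyEq (hF : IsSynchronousFrame D x F) :
    torsionNormSq T =ᶠ[𝓝 x] fun y ↦ ∑ j, torsionSq T y (F j y) (F j y) := by
  filter_upwards [hF.eventually_exists_basis] with y ⟨b, hb⟩
  simp only [torsionNormSq_eq_sum_torsionSq b, hb]

theorem IsSynchronousFrame.smooth_torsionSq (hF : IsSynchronousFrame D x F)
    (hT : IsSmoothForm I T) (j k : ι) :
    SmoothFunNear I x fun y ↦ torsionSq T y (F j y) (F k y) :=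
  have hs (i j k) := hT.smoothFunNear (hF.smooth i) (hF.smooth j) (hF.smooth k)
  .congr (.sum fun a _ ↦ .sum fun b _ ↦ (hs j a b).mul (hs k a b))
    (hF.torsionSq_eventuallyEq j k).symm

theorem IsSynchronousFrame.mvfderiv_torsionSq (hF : IsSynchronousFrame D x F)
    (hT : IsSmoothForm I T) (j k : ι) (u : TangentSpace I x) :
    d% (fun y ↦ torsionSq T y (F j y) (F k y)) x u =
      ∑ a, ∑ b, (T x ![F j x, F a x, F b x] * covDerivForm I D T x u ![F k x, F a x, F b x] +
        T x ![F k x, F a x, F b x] * covDerivForm I D T x u ![F j x, F a x, F b x]) := by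
  have hs (i j k) := hT.smoothFunNear (hF.smooth i) (hF.smooth j) (hF.smooth k)
  rw [mvfderiv_congr (hF.torsionSq_eventuallyEq j k), mvfderiv_finsetSum fun a _ ↦
    (SmoothFunNear.sum fun b _ ↦ (hs j a b).mul (hs k a b)).mdiff, _root_.sum_apply]
  refine Finset.sum_congr rfl fun a _ ↦ ?_
  rw [mvfderiv_finsetSum fun b _ ↦ ((hs j a b).mul (hs k a b)).mdiff, _root_.sum_apply]
  refine Finset.sum_congr rfl fun b _ ↦ ?_
  rw [mvfderiv_fun_mul (hs j a b).mdiff (hs k a b).mdiff,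
    (hF.parallel k).covDerivForm_eq (hF.parallel a) (hF.parallel b) hT,
    (hF.parallel j).covDerivForm_eq (hF.parallel a) (hF.parallel b) hT]
  rfl

theorem IsSynchronousFrame.mvfderiv_torsionNormSq (hF : IsSynchronousFrame D x F)
    (hT : IsSmoothForm I T) (u : TangentSpace I x) :
    d% (torsionNormSq T) x u = 2 * ∑ a, ∑ b, ∑ c,
      T x ![F a x, F b x, F c x] * covDerivForm I D T x u ![F a x, F b x, F c x] := by
  rw [mvfderiv_congr hF.torsionNormSq_eventuallyEq,
    mvfderiv_finsetSum fun j _ ↦ (hF.smooth_torsionSq hT j j).mdiff, _root_.sum_apply]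
  simp only [hF.mvfderiv_torsionSq hT, ← two_mul, Finset.mul_sum]

theorem three_mul_div_torsionSq {F : _ → Π x : M, TangentSpace I x}
    (hF : IsSynchronousFrame (leviCivita I) x F) (hFx : ∀ i, F i x = frame I x i)
    (hT : IsSmoothForm I T) (m) :
    3 * ∑ k, d% (fun y ↦ torsionSq T y (F m y) (F k y)) x (F k x) =
      1 / 2 * d% (torsionNormSq T) x (F m x) -
        (3 * theta I T x (F m x) + bigTheta I T x (F m x)) := by
  simp only [hF.mvfderiv_torsionSq hT, hF.mvfderiv_torsionNormSq hT, theta_eq_sum, bigTheta_eq_sum,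
    hFx, Finset.sum_add_distrib]
  ring

end TorsionOneForms

section NablaEinstein

variable [IsManifold I ∞ M] [FiniteDimensional ℝ E]
  [RiemannianBundle (fun x : M ↦ TangentSpace I x)]
  {D : CovariantDerivative I E (fun x : M ↦ TangentSpace I x)}
  {T : Π x : M, TangentSpace I x [⋀^Fin 3]→L[ℝ] ℝ} {x : M}

theorem IsNablaEinstein.finrank_mul_ricci_symm (hE : IsNablaEinstein I D) (u v : TangentSpace I x) :
    Module.finrank ℝ E * ((ricci I D x u v + ricci I D x v u) / 2) =
      scalarCurvature I D x * inner ℝ u v := by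
  obtain ⟨f, hf⟩ := hE
  have scalar_eq : scalarCurvature I D x = Module.finrank ℝ E * f x := by
    have diagonal (i) : ricci I D x (frame I x i) (frame I x i) = f x := by
      simpa using hf x (frame I x i) (frame I x i)
    simp only [scalarCurvature, diagonal, Finset.sum_const, Finset.card_univ, Fintype.card_fin,
      nsmul_eq_mul]
    rfl
  rw [hf, scalar_eq, mul_assoc]

variable [IsContMDiffRiemannianBundle I ∞ E (fun x : M ↦ TangentSpace I x)]

theorem smoothFunNear_scalarCurvature (hD : SmoothConn D)
    (hm : D.IsMetricCompatible (V := fun x : M ↦ TangentSpace I x)) (x : M) :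
    SmoothFunNear I x (scalarCurvature I D) := by
  obtain ⟨F, hF, -⟩ := exists_isSynchronousFrame hm (frame I x)
  exact .congr (.sum fun j _ ↦ hF.smooth_ricci hD j j) (hF.scalarCurvature_eventuallyEq hD).symm

theorem smoothFunNear_scalarCurvature_leviCivita (x : M) :
    SmoothFunNear I x (scalarCurvature I (leviCivita I)) :=
  smoothFunNear_scalarCurvature (smoothConn_leviCivita I M) (leviCivita_isMetricCompatible I) x

theorem smoothFunNear_scalarCurvature_torsionConnection (hT : IsSmoothForm I T) (x : M) :
    SmoothFunNear I x (scalarCurvature I (torsionConnection I T)) :=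
  smoothFunNear_scalarCurvature (smoothConn_torsionConnection hT)
    (torsionConnection_isMetricCompatible I T) x

theorem IsNablaEinstein.finrank_mul_ricci_leviCivita
    (hE : IsNablaEinstein I (torsionConnection I T)) (hT : IsSmoothForm I T)
    (u v : TangentSpace I x) :
    Module.finrank ℝ E * ricci I (leviCivita I) x u v =
      scalarCurvature I (torsionConnection I T) x * inner ℝ u v +
        Module.finrank ℝ E / 4 * torsionSq T x u v := by
  rw [ricci_leviCivita_eq hT, mul_add, hE.finrank_mul_ricci_symm]
  ring

theorem IsNablaEinstein.finrank_mul_div_ricci {ι : Type*} [Fintype ι]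
    {F : ι → Π x : M, TangentSpace I x} (hE : IsNablaEinstein I (torsionConnection I T))
    (hT : IsSmoothForm I T) (hF : IsSynchronousFrame (leviCivita I) x F) (m : ι) :
    Module.finrank ℝ E * ∑ i, d% (fun y ↦ ricci I (leviCivita I) y (F m y) (F i y)) x (F i x) =
      d% (scalarCurvature I (torsionConnection I T)) x (F m x) +
        Module.finrank ℝ E / 4 *
          ∑ i, d% (fun y ↦ torsionSq T y (F m y) (F i y)) x (F i x) := by
  classical
  set n : ℝ := (Module.finrank ℝ E : ℝ)
  set S := scalarCurvature I (torsionConnection I T)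
  let Q (i) (y : M) := torsionSq T y (F m y) (F i y)
  have hS : SmoothFunNear I x S := smoothFunNear_scalarCurvature_torsionConnection hT x
  have hQ (i) : SmoothFunNear I x (Q i) := hF.smooth_torsionSq hT m i
  have ricci_eq (i) : (fun y ↦ n * ricci I (leviCivita I) y (F m y) (F i y)) =ᶠ[𝓝 x]
      fun y ↦ (if m = i then 1 else 0) * S y + n / 4 * Q i y := by
    filter_upwards [hF.orthonormal] with y hy
    rw [hE.finrank_mul_ricci_leviCivita hT, orthonormal_iff_ite.1 hy, mul_comm (S y)]
  have d_ricci (i) : n * d% (fun y ↦ ricci I (leviCivita I) y (F m y) (F i y)) x (F i x) =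
      (if m = i then 1 else 0) * d% S x (F i x) + n / 4 * d% (Q i) x (F i x) := by
    have h : d% (fun y ↦ n * ricci I (leviCivita I) y (F m y) (F i y)) x =
      d% (fun y ↦ (if m = i then 1 else 0) * S y + n / 4 * Q i y) x := mvfderiv_congr (ricci_eq i)
    rw [mvfderiv_fun_add ((SmoothFunNear.const _).mul hS).mdiff
      ((SmoothFunNear.const _).mul (hQ i)).mdiff, mvfderiv_const_mul _ hS.mdiff,
      mvfderiv_const_mul _ (hQ i).mdiff,
      mvfderiv_const_mul _ (hF.smooth_ricci (smoothConn_leviCivita I M) m i).mdiff] at h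
    exact congrArg (fun L ↦ L (F i x)) h
  rw [Finset.mul_sum]
  simp only [d_ricci, Finset.sum_add_distrib, ite_mul, one_mul, zero_mul, Finset.sum_ite_eq,
    Finset.mem_univ, if_true, Finset.mul_sum, Q]

theorem mvfderiv_torsionNormSq_eq (hT : IsSmoothForm I T) (x : M) :
    d% (torsionNormSq T) x = (4 : ℝ) • (d% (scalarCurvature I (leviCivita I (M := M))) x -
      d% (scalarCurvature I (torsionConnection I T)) x) := by
  have hS := smoothFunNear_scalarCurvature_leviCivita (I := I) x
  have hS' := smoothFunNear_scalarCurvature_torsionConnection hT x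
  rw [← mvfderiv_fun_sub hS.mdiff hS'.mdiff, ← mvfderiv_const_mul 4 (hS.sub hS').mdiff]
  refine congrArg (fun f : M → ℝ ↦ d% f x) (funext fun y ↦ ?_)
  rw [scalarCurvature_leviCivita_eq hT]
  ring

theorem IsNablaEinstein.mvfderiv_scalarCurvature_frame
    (hE : IsNablaEinstein I (torsionConnection I T)) (hT : IsSmoothForm I T) (x : M) (m) :
    4 * Module.finrank ℝ E * d% (scalarCurvature I (leviCivita I (M := M))) x (frame I x m) +
        2 * (Module.finrank ℝ E - 6) *
          d% (scalarCurvature I (torsionConnection I T)) x (frame I x m) =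
      -(Module.finrank ℝ E * (3 * theta I T x (frame I x m) + bigTheta I T x (frame I x m))) := by
  obtain ⟨F, hF, hFx⟩ := exists_isSynchronousFrame (leviCivita_isMetricCompatible I) (frame I x)
  have bianchi := contracted_bianchi (smoothConn_leviCivita I M) (leviCivita_isMetricCompatible I)
    (leviCivita_torsion I) hF m
  have div_ricci := hE.finrank_mul_div_ricci hT hF m
  have div_torsionSq := three_mul_div_torsionSq hF hFx hT m
  rw [mvfderiv_torsionNormSq_eq hT, _root_.smul_apply, _root_.sub_apply, smul_eq_mul]
    at div_torsionSq
  rw [← hFx]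
  linear_combination 6 * Module.finrank ℝ E * bianchi + 12 * div_ricci +
    Module.finrank ℝ E * div_torsionSq

theorem IsNablaEinstein.mvfderiv_scalarCurvature_eq_zero
    (hE : IsNablaEinstein I (torsionConnection I T)) (hT : IsSmoothForm I T)
    (hθ : ∀ u : TangentSpace I x, 3 * theta I T x u + bigTheta I T x u = 0) :
    d% (fun y : M ↦ 2 * Module.finrank ℝ E * scalarCurvature I (leviCivita I) y +
      (Module.finrank ℝ E - 6) * scalarCurvature I (torsionConnection I T) y) x = 0 := by
  have hS := smoothFunNear_scalarCurvature_leviCivita (I := I) x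
  have hS' := smoothFunNear_scalarCurvature_torsionConnection hT x
  rw [mvfderiv_fun_add ((SmoothFunNear.const _).mul hS).mdiff
    ((SmoothFunNear.const _).mul hS').mdiff, mvfderiv_const_mul _ hS.mdiff,
    mvfderiv_const_mul _ hS'.mdiff]
  refine ContinuousLinearMap.coe_injective ((frame I x).toBasis.ext fun m ↦ ?_)
  have frame_eq := hE.mvfderiv_scalarCurvature_frame hT x m
  rw [hθ, mul_zero, neg_zero] at frame_eq
  simp only [OrthonormalBasis.coe_toBasis, ContinuousLinearMap.coe_coe, _root_.add_apply,
    _root_.smul_apply, _root_.zero_apply, smul_eq_mul]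
  linear_combination frame_eq / 2

theorem IsHarmonic.three_mul_theta_add_bigTheta (hT : IsHarmonic I T) (x : M)
    (u : TangentSpace I x) : 3 * theta I T x u + bigTheta I T x u = 0 := by
  obtain ⟨closed, coclosed⟩ := hT
  simp [theta, bigTheta, closed, coclosed]

end NablaEinstein

section ConstantFunctions

variable [IsManifold I ∞ M] [I.Boundaryless] {f : M → ℝ}

theorem isLocallyConstant_of_mvfderiv_eq_zero (hf : ∀ x, MDiffAt f x) (h : ∀ x, d% f x = 0) :
    IsLocallyConstant f := by
  rw [IsLocallyConstant.iff_eventually_eq]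
  intro x
  set φ := extChartAt I x
  have open_target : IsOpen φ.target := isOpen_extChartAt_target x
  obtain ⟨r, hr, ball_subset⟩ := Metric.isOpen_iff.1 open_target (φ x) (mem_extChartAt_target x)
  have chart_deriv : ∀ z ∈ Metric.ball (φ x) r, HasFDerivAt (f ∘ φ.symm) (0 : E →L[ℝ] ℝ) z := by
    intro z hz
    have hφ : MDifferentiableAt 𝓘(ℝ, E) I φ.symm z :=
      ((contMDiffOn_extChartAt_symm (n := ∞) x).contMDiffAt
        (open_target.mem_nhds (ball_subset hz))).mdifferentiableAt (by simp)
    have hf_z := (hf (φ.symm z)).hasMFDerivAt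
    have mfderiv_eq_zero : mfderiv I 𝓘(ℝ, ℝ) f (φ.symm z) = 0 := by
      ext v
      exact congrArg (fun L ↦ L v) (h (φ.symm z))
    rw [mfderiv_eq_zero] at hf_z
    simpa only [ContinuousLinearMap.zero_comp] using! (hf_z.comp z hφ.hasMFDerivAt).hasFDerivAt
  filter_upwards [(continuousAt_extChartAt (I := I) x).preimage_mem_nhds
    (Metric.ball_mem_nhds _ hr), extChartAt_source_mem_nhds (I := I) x] with y hy hys
  have const_on_ball := Metric.isOpen_ball.is_const_of_fderiv_eq_zero (𝕜 := ℝ)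
    (convex_ball (φ x) r).isPreconnected
    (fun z hz ↦ (chart_deriv z hz).differentiableAt.differentiableWithinAt)
    (fun z hz ↦ (chart_deriv z hz).fderiv) hy (Metric.mem_ball_self hr)
  rwa [Function.comp_apply, Function.comp_apply, φ.left_inv hys, extChartAt_to_inv] at const_on_ball

theorem exists_eq_const_of_mvfderiv_eq_zero [PreconnectedSpace M] (hf : ∀ x, MDiffAt f x)
    (h : ∀ x, d% f x = 0) : ∃ c, ∀ x, f x = c := by
  obtain ⟨c, hc⟩ := (isLocallyConstant_of_mvfderiv_eq_zero hf h).exists_eq_const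
  exact ⟨c, congrFun hc⟩

end ConstantFunctions

end

end TorsionGeometry

open TorsionGeometry in
theorem mainTheorem6_general {E : Type*} [NormedAddCommGroup E] [NormedSpace ℝ E]
    [FiniteDimensional ℝ E] {H : Type*} [TopologicalSpace H] {I : ModelWithCorners ℝ E H}
    [I.Boundaryless] {M : Type*} [TopologicalSpace M] [PreconnectedSpace M] [ChartedSpace H M]
    [IsManifold I ∞ M] [RiemannianBundle (fun x : M ↦ TangentSpace I x)]
    [IsContMDiffRiemannianBundle I ∞ E (fun x : M ↦ TangentSpace I x)]
    {T : Π x : M, TangentSpace I x [⋀^Fin 3]→L[ℝ] ℝ} (hT : IsSmoothForm I T)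
    (hθ : ∀ (x : M) (u : TangentSpace I x), 3 * theta I T x u + bigTheta I T x u = 0)
    (hE : IsNablaEinstein I (torsionConnection I T)) :
    ∃ c : ℝ, ∀ x : M, 2 * Module.finrank ℝ E * scalarCurvature I (leviCivita I) x +
      (Module.finrank ℝ E - 6) * scalarCurvature I (torsionConnection I T) x = c := by
  refine exists_eq_const_of_mvfderiv_eq_zero (fun x ↦ ?_)
    fun x ↦ hE.mvfderiv_scalarCurvature_eq_zero hT (hθ x)
  exact (((SmoothFunNear.const _).mul (smoothFunNear_scalarCurvature_leviCivita x)).add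
    ((SmoothFunNear.const _).mul (smoothFunNear_scalarCurvature_torsionConnection hT x))).mdiff

theorem mainTheorem6 {M : Type*} [TopologicalSpace M] [T2Space M] [PreconnectedSpace M]
    [ChartedSpace (EuclideanSpace ℝ (Fin 6)) M] [IsManifold (𝓡 6) ∞ M]
    [RiemannianBundle (fun x : M ↦ TangentSpace (𝓡 6) x)]
    [IsContMDiffRiemannianBundle (𝓡 6) ∞ (EuclideanSpace ℝ (Fin 6))
      (fun x : M ↦ TangentSpace (𝓡 6) x)]
    (T : Π x : M, TangentSpace (𝓡 6) x [⋀^Fin 3]→L[ℝ] ℝ) (hT : TorsionGeometry.IsSmoothForm (𝓡 6) T) :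
    (TorsionGeometry.IsHarmonic (𝓡 6) T →
      ∀ (x : M) (u : TangentSpace (𝓡 6) x),
        3 * TorsionGeometry.theta (𝓡 6) T x u +
          TorsionGeometry.bigTheta (𝓡 6) T x u = 0) ∧
    ((∀ (x : M) (u : TangentSpace (𝓡 6) x),
        3 * TorsionGeometry.theta (𝓡 6) T x u +
          TorsionGeometry.bigTheta (𝓡 6) T x u = 0) →
      TorsionGeometry.IsNablaEinstein (𝓡 6) (TorsionGeometry.torsionConnection (𝓡 6) T) →
      ∃ c : ℝ, ∀ x : M,
        TorsionGeometry.scalarCurvature (𝓡 6) (TorsionGeometry.leviCivita (𝓡 6) (M := M)) x = c) := by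
  refine ⟨fun h ↦ h.three_mul_theta_add_bigTheta, fun hθ hE ↦ ?_⟩
  obtain ⟨c, hc⟩ := mainTheorem6_general hT hθ hE
  exact ⟨c / 12, fun x ↦ by
    have := hc x
    rw [finrank_euclideanSpace_fin] at this
    push_cast at this
    linarith⟩
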